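/- Let $H\in(0,1)$ and $K\in(0,1]$, and let $B=\{B(t),\,t\ge 0\}$ be a real-valued bifractional Brownian motion with indices $H,K$, that is, a centered Gaussian process with $B(0)=0$ almost surely and covariance function $$\mathbb E\big(B(s)B(t)\big)=\frac1{2^K}\Big[(t^{2H}+s^{2H})^K-|t-s|^{2HK}\Big],\qquad s,t\ge 0.$$ Assume that $B$ has almost surely continuous sample paths. For $t\in[0,1]$ and $\varepsilon>0$ let $$Z_\varepsilon(t)=\frac{B(t+\varepsilon)-B(t)}{\varepsilon^{HK}},$$ let $\rho$ be a centered normal random variable with variance $2^{1-K}$, and let $\lambda$ be Lebesgue measure on $\mathbb R$. Then the following statements hold. (i) For every integer $k\ge 1$, almost surely, $$\int_0^1 \big(Z_\varepsilon(t)\big)^k\,dt\;\longrightarrow\;\mathbb E(\rho^k)\qquad\text{as }\varepsilon\downarrow 0.$$ (ii) For every interval $J\subset[0,1]$, almost surely, for every $x\in\mathbb R$, $$\lambda\{t\in J:\ Z_\varepsilon(t)\le x\}\;\longrightarrow\;\lambda(J)\,\mathbb P(\rho\le x)\qquad\text{as }\varepsilon\downarrow 0.$$ -/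

import Mathlib

open MeasureTheory ProbabilityTheory Filter Topology
open scoped NNReal

noncomputable section

/-- The covariance function of bifractional Brownian motion with indices `H` and `K`:
`R(s, t) = 2^{-K} ((t^{2H} + s^{2H})^K - |t - s|^{2HK})`. -/
def bifBmCov (H K s t : ℝ) : ℝ :=
  1 / 2 ^ K * ((t ^ (2 * H) + s ^ (2 * H)) ^ K - |t - s| ^ (2 * H * K))

/-- `B = {B(t), t ≥ 0}` is a (real-valued) bifractional Brownian motion with indices `H` and `K`
on the probability space `(Ω, P)`: a centered Gaussian process with covariance function
`bifBmCov H K`, started at `0`. -/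
structure IsBifBm {Ω : Type*} [MeasurableSpace Ω] (H K : ℝ) (B : ℝ≥0 → Ω → ℝ)
    (P : Measure Ω) : Prop where
  isGaussianProcess : IsGaussianProcess B P
  centered : ∀ t, ∫ ω, B t ω ∂P = 0
  covariance_eq : ∀ s t : ℝ≥0, cov[B s, B t; P] = bifBmCov H K s t
  start_zero : ∀ᵐ ω ∂P, B 0 ω = 0

/-- The normalized increment `Z_ε(t) = (B(t + ε) - B(t)) / ε^{HK}` along the path `ω`. It is only
used for `t ≥ 0` and `ε > 0`, where `Real.toNNReal` is the inclusion of the time axis. -/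
def bifBmZ {Ω : Type*} (H K : ℝ) (B : ℝ≥0 → Ω → ℝ) (ε t : ℝ) (ω : Ω) : ℝ :=
  (B (t + ε).toNNReal ω - B t.toNNReal ω) / ε ^ (H * K)

end

/-!
The claim is a law of large numbers for the path-dependent averages `∫_J f (Z_ε(t)) dt`. It is
proved for every `f` that is locally Lipschitz with polynomially growing constant (`PolyLip`), in
`IsBifBm.ae_tendsto_integral_comp`. Powers belong to this class and give the convergence of
moments. Piecewise linear approximations of the indicators of half-lines, with rational endpoints,
give the convergence of the distribution functions
(`tendsto_measureReal_le_of_tendsto_ramp`).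

The mean converges because `Var Z_ε(t) → 2 ^ (1 - K)` for each `t > 0`. The variance of the average
is the double integral of `cov (f (Z_ε(s)), f (Z_ε(t)))`. For jointly Gaussian variables this
covariance is bounded linearly by `cov (Z_ε(s), Z_ε(t))` (`PolyLip.abs_cov_comp_le`), which is
`ε ^ (-2HK)` times a mixed second difference of the covariance function of the process. Away from
the axes and the diagonal the covariance function is smooth, and two applications of the mean value
inequality bound the mixed difference by a multiple of `ε ^ 2`, with a constant polynomial in the
inverse distance `η⁻¹`. As `HK < 1`, choosing `η` as a small power of `ε` shows that the variance
of the average is bounded by a positive power of `ε` (`IsBifBm.exists_lintegral_sq_le`).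

Hence the averages converge almost surely along `ε = n ^ (-q)` for `q` large
(`IsBifBm.ae_tendsto_integral_grid`). Consecutive points of this grid have ratio `1 + O(1 / n)`, so
Hölder continuity of the paths of an order `γ < HK` close to `HK` (`IsBifBm.ae_exists_holder`)
makes `Z_ε` uniformly close to `Z_e`, where `e` is the grid point next to `ε`, and the convergence
extends to all `ε ↓ 0`.
-/

/-! ### Functions with polynomially growing Lipschitz constant -/

/-- `PolyLip f C m` says that `f` is locally Lipschitz with a constant of polynomial growth:
`|f x - f y| ≤ C |x - y| ((1 + |x|) (1 + |y|)) ^ m`. The product form of the weight makes it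
factor along independent variables. Powers and bounded Lipschitz functions both qualify. -/
structure PolyLip (f : ℝ → ℝ) (C : ℝ) (m : ℕ) : Prop where
  nonneg : 0 ≤ C
  bound : ∀ x y, |f x - f y| ≤ C * |x - y| * ((1 + |x|) * (1 + |y|)) ^ m

namespace PolyLip

variable {f : ℝ → ℝ} {C : ℝ} {m : ℕ}

lemma growth (hf : PolyLip f C m) (x : ℝ) :
    |f x| ≤ (|f 0| + C) * (1 + |x|) ^ (m + 1) := by
  have h := hf.bound x 0
  simp only [sub_zero, abs_zero, add_zero, mul_one] at h
  have h1 : |f x| ≤ |f 0| + |f x - f 0| := by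
    have := abs_add_le (f 0) (f x - f 0)
    simpa using this
  have hx := abs_nonneg x
  have hp : (1 : ℝ) ≤ (1 + |x|) ^ (m + 1) := one_le_pow₀ (by linarith)
  have h2 : C * |x| * (1 + |x|) ^ m ≤ C * (1 + |x|) ^ (m + 1) := by
    rw [pow_succ, mul_assoc, mul_comm |x|]
    have := hf.nonneg
    gcongr
    linarith
  nlinarith [abs_nonneg (f 0)]

protected lemma continuous (hf : PolyLip f C m) : Continuous f := by
  rw [continuous_iff_continuousAt]
  intro x
  rw [ContinuousAt, tendsto_iff_dist_tendsto_zero]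
  have h : Tendsto (fun y => C * |y - x| * ((1 + |y|) * (1 + |x|)) ^ m) (𝓝 x) (𝓝 0) := by
    have : Continuous fun y => C * |y - x| * ((1 + |y|) * (1 + |x|)) ^ m := by fun_prop
    simpa using this.tendsto x
  exact squeeze_zero (fun _ => dist_nonneg) (fun y => by simpa [Real.dist_eq] using hf.bound y x) h

end PolyLip

lemma polyLip_pow (k : ℕ) : PolyLip (fun x => x ^ k) k (k - 1) where
  nonneg := Nat.cast_nonneg k
  bound x y := by
    have h := abs_pow_sub_pow_le x y k
    refine h.trans ?_
    rw [mul_comm |x - y|]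
    gcongr
    have hx := abs_nonneg x
    have hy := abs_nonneg y
    apply max_le <;> nlinarith [mul_nonneg hx hy]

lemma polyLip_one_add_abs_pow (k : ℕ) : PolyLip (fun x => (1 + |x|) ^ k) k (k - 1) where
  nonneg := Nat.cast_nonneg k
  bound x y := by
    have hx := abs_nonneg x
    have hy := abs_nonneg y
    refine (abs_pow_sub_pow_le (1 + |x|) (1 + |y|) k).trans ?_
    have h1 : |1 + |x| - (1 + |y|)| ≤ |x - y| := by
      rw [add_sub_add_left_eq_sub]
      exact abs_abs_sub_abs_le_abs_sub x y
    have h2 : max |(1 + |x|)| |(1 + |y|)| ≤ (1 + |x|) * (1 + |y|) := by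
      rw [abs_of_nonneg (by positivity : 0 ≤ 1 + |x|), abs_of_nonneg (by positivity : 0 ≤ 1 + |y|)]
      apply max_le <;> nlinarith [mul_nonneg hx hy]
    have h3 : 0 ≤ max |(1 + |x|)| |(1 + |y|)| := (abs_nonneg _).trans (le_max_left _ _)
    rw [mul_comm (k : ℝ)]
    gcongr

/-! ### Moments and covariances of functions of Gaussian variables -/

lemma integrable_one_add_abs_pow (v : ℝ≥0) (n : ℕ) :
    Integrable (fun x : ℝ => (1 + |x|) ^ n) (gaussianReal 0 v) := by
  have h : MemLp (fun x : ℝ => 1 + |x|) n (gaussianReal 0 v) := by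
    have h1 : MemLp (fun x : ℝ => x) n (gaussianReal 0 v) := by
      have := memLp_id_gaussianReal (μ := 0) (v := v) (n : ℝ≥0)
      rwa [ENNReal.coe_natCast] at this
    have h2 : MemLp (fun _ : ℝ => (1 : ℝ)) n (gaussianReal 0 v) := memLp_const 1
    have h3 : MemLp (fun x : ℝ => |x|) n (gaussianReal 0 v) := h1.norm
    exact h2.add h3
  refine (h.integrable_norm_pow').congr (ae_of_all _ fun x => ?_)
  simp only [Real.norm_eq_abs]
  rw [abs_of_nonneg (by positivity)]

/-- `E (1 + 2 |g|) ^ n` for a standard normal `g`, a bound for `E (1 + |X|) ^ n` that is uniform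
over the centered normal variables `X` of variance at most `2`. -/
noncomputable def gaussMoment (n : ℕ) : ℝ := ∫ x, (1 + 2 * |x|) ^ n ∂(gaussianReal 0 1)

lemma map_sqrt_mul_gaussianReal (v : ℝ≥0) :
    (gaussianReal 0 1).map (fun x => √v * x) = gaussianReal 0 v := by
  rw [gaussianReal_map_const_mul]
  congr 1
  · simp
  · ext; simp

lemma integral_one_add_abs_pow_le {v : ℝ≥0} (hv : v ≤ 2) (n : ℕ) :
    ∫ x, (1 + |x|) ^ n ∂(gaussianReal 0 v) ≤ gaussMoment n := by
  rw [← map_sqrt_mul_gaussianReal, integral_map (by fun_prop) (by fun_prop)]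
  have hs : √(v : ℝ) ≤ 2 := by
    rw [Real.sqrt_le_left (by norm_num)]
    have : (v : ℝ) ≤ 2 := by exact_mod_cast hv
    linarith
  have hs0 := Real.sqrt_nonneg (v : ℝ)
  apply integral_mono_of_nonneg
  · exact ae_of_all _ fun x => by positivity
  · refine ((integrable_one_add_abs_pow 1 n).const_mul (2 ^ n)).mono' (by fun_prop)
      (ae_of_all _ fun x => ?_)
    have hx := abs_nonneg x
    rw [Real.norm_of_nonneg (by positivity), ← mul_pow]
    gcongr
    linarith
  · refine ae_of_all _ fun x => ?_
    simp only [abs_mul, abs_of_nonneg hs0]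
    gcongr

lemma gaussMoment_nonneg (n : ℕ) : 0 ≤ gaussMoment n :=
  integral_nonneg fun x => by positivity

lemma abs_integral_le_of_abs_le {α : Type*} [MeasurableSpace α] {μ : Measure α} {f g : α → ℝ}
    (hg : Integrable g μ) (h : ∀ x, |f x| ≤ g x) : |∫ x, f x ∂μ| ≤ ∫ x, g x ∂μ := by
  simpa only [Real.norm_eq_abs] using norm_integral_le_of_norm_le (f := f) hg (ae_of_all _ h)

section RandomVariable

variable {Ω : Type*} [MeasurableSpace Ω] {P : Measure Ω} {X Y : Ω → ℝ} {f : ℝ → ℝ} {C : ℝ} {m : ℕ}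

lemma ProbabilityTheory.HasGaussianLaw.hasLaw_of_centered (hX : HasGaussianLaw X P)
    (h0 : ∫ ω, X ω ∂P = 0) : HasLaw X (gaussianReal 0 (Var[X; P]).toNNReal) P where
  aemeasurable := hX.aemeasurable
  map_eq := by rw [hX.map_eq_gaussianReal, h0]

lemma ProbabilityTheory.HasGaussianLaw.integrable_pow (hX : HasGaussianLaw X P)
    (h0 : ∫ ω, X ω ∂P = 0) (n : ℕ) : Integrable (fun ω => (1 + |X ω|) ^ n) P := by
  have h := integrable_one_add_abs_pow (Var[X; P]).toNNReal n
  rw [← (hX.hasLaw_of_centered h0).map_eq] at h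
  exact h.comp_aemeasurable hX.aemeasurable

lemma ProbabilityTheory.HasGaussianLaw.integral_pow_le (hX : HasGaussianLaw X P)
    (h0 : ∫ ω, X ω ∂P = 0) (hv : Var[X; P] ≤ 2) (n : ℕ) :
    ∫ ω, (1 + |X ω|) ^ n ∂P ≤ gaussMoment n := by
  have h := integral_one_add_abs_pow_le (v := (Var[X; P]).toNNReal)
    (by rw [← NNReal.coe_le_coe, Real.coe_toNNReal _ (variance_nonneg _ _)]; exact_mod_cast hv) n
  rw [← (hX.hasLaw_of_centered h0).map_eq,
    integral_map hX.aemeasurable (by fun_prop)] at h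
  exact h

lemma PolyLip.integrable_sq_comp (hf : PolyLip f C m) (hX : HasGaussianLaw X P)
    (h0 : ∫ ω, X ω ∂P = 0) : Integrable (fun ω => f (X ω) ^ 2) P := by
  have hm := hf.continuous.measurable.comp_aemeasurable hX.aemeasurable
  refine ((hX.integrable_pow h0 ((m + 1) * 2)).const_mul ((|f 0| + C) ^ 2)).mono'
    (hm.pow_const 2).aestronglyMeasurable (ae_of_all _ fun ω => ?_)
  rw [pow_mul, ← mul_pow, Real.norm_of_nonneg (sq_nonneg _), ← sq_abs]
  exact pow_le_pow_left₀ (abs_nonneg _) (hf.growth _) 2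

lemma PolyLip.integral_sq_comp_le (hf : PolyLip f C m) (hX : HasGaussianLaw X P)
    (h0 : ∫ ω, X ω ∂P = 0) (hv : Var[X; P] ≤ 2) :
    ∫ ω, f (X ω) ^ 2 ∂P ≤ (|f 0| + C) ^ 2 * gaussMoment ((m + 1) * 2) := by
  calc ∫ ω, f (X ω) ^ 2 ∂P ≤ ∫ ω, (|f 0| + C) ^ 2 * (1 + |X ω|) ^ ((m + 1) * 2) ∂P := by
        refine integral_mono (hf.integrable_sq_comp hX h0)
          ((hX.integrable_pow h0 _).const_mul _) fun ω => ?_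
        rw [pow_mul, ← mul_pow, ← sq_abs]
        exact pow_le_pow_left₀ (abs_nonneg _) (hf.growth _) 2
    _ ≤ _ := by
        rw [integral_const_mul]
        exact mul_le_mul_of_nonneg_left (hX.integral_pow_le h0 hv _) (sq_nonneg _)

lemma PolyLip.memLp_two_comp (hf : PolyLip f C m) (hX : HasGaussianLaw X P)
    (h0 : ∫ ω, X ω ∂P = 0) : MemLp (fun ω => f (X ω)) 2 P := by
  exact (memLp_two_iff_integrable_sq
    (hf.continuous.measurable.comp_aemeasurable hX.aemeasurable).aestronglyMeasurable).2
    (hf.integrable_sq_comp hX h0)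

/-- For jointly Gaussian `X` and `Y`, the covariance of `f X` and `f Y` is controlled linearly by
that of `X` and `Y`. Write `Y = a X + W` with `W` independent of `X`; then `f Y` can be replaced by
`f Y - f W`, which is of size `|a| = |cov(X, Y)| / Var X`. The lower bound on `Var X` keeps this
ratio under control. -/
lemma PolyLip.abs_cov_comp_le [IsProbabilityMeasure P] (hf : PolyLip f C m)
    (hXY : HasGaussianLaw (fun ω => (X ω, Y ω)) P)
    (hX0 : ∫ ω, X ω ∂P = 0) (hY0 : ∫ ω, Y ω ∂P = 0) (hX2 : Var[X; P] ≤ 2) (hY2 : Var[Y; P] ≤ 2)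
    (hX1 : 1 / 2 ≤ Var[X; P]) :
    |cov[fun ω => f (X ω), fun ω => f (Y ω); P]| ≤
      (|f 0| + C) * (2 * C * 2 ^ m) * (gaussMoment (m + 1 + (m + 1)) * gaussMoment (2 * m) +
        gaussMoment (m + 1) * (gaussMoment (m + 1) * gaussMoment (2 * m))) *
        |cov[X, Y; P]| := by
  set v := Var[X; P] with hv
  set a := cov[X, Y; P] / v with ha
  have hv0 : 0 < v := by linarith
  have hX := hXY.fst
  have hY := hXY.snd
  let L : ℝ × ℝ →L[ℝ] ℝ × ℝ := (ContinuousLinearMap.fst ℝ ℝ ℝ).prod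
    (ContinuousLinearMap.snd ℝ ℝ ℝ - a • ContinuousLinearMap.fst ℝ ℝ ℝ)
  set W : Ω → ℝ := fun ω => Y ω - a * X ω with hW
  have hXW : HasGaussianLaw (fun ω => (X ω, W ω)) P := by
    simpa [L] using hXY.map_fun L
  have hWG := hXW.snd
  have hW0 : ∫ ω, W ω ∂P = 0 := by
    rw [hW, integral_sub hY.integrable (hX.integrable.const_mul a), integral_const_mul, hX0, hY0]
    simp
  have hcov : cov[X, W; P] = 0 := by
    have : W = Y - a • X := by ext ω; simp [hW]
    rw [this, covariance_sub_right hX.memLp_two hY.memLp_two (hX.memLp_two.const_smul a),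
      covariance_smul_right, covariance_self hX.aemeasurable, ← hv, ha]
    field_simp
    simp
  have hind : IndepFun X W P := hXW.indepFun_of_covariance_eq_zero hcov
  -- Orthogonal decomposition of the variance of `Y = a X + W`.
  have hvar : Var[Y; P] = a ^ 2 * v + Var[W; P] := by
    have : Y = (a • X) + W := by ext ω; simp [hW]
    rw [this, variance_add (hX.memLp_two.const_smul a) hWG.memLp_two, covariance_smul_left, hcov,
      variance_smul]
    simp [hv]
  have hWv : Var[W; P] ≤ 2 := by nlinarith [mul_nonneg (sq_nonneg a) hv0.le]
  have ha2 : |a| ≤ 2 := by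
    have h1 := variance_nonneg W P
    rw [← Real.sqrt_sq_eq_abs]
    apply Real.sqrt_le_left (by norm_num) |>.2
    nlinarith [sq_nonneg a]
  have hac : |a| ≤ 2 * |cov[X, Y; P]| := by
    rw [ha, abs_div, abs_of_pos hv0, div_le_iff₀ hv0]
    nlinarith [abs_nonneg cov[X, Y; P]]
  have hC := hf.nonneg
  have hfX := hf.memLp_two_comp hX hX0
  have hfY := hf.memLp_two_comp hY hY0
  have hfW := hf.memLp_two_comp hWG hW0
  have hfind : IndepFun (fun ω => f (X ω)) (fun ω => f (W ω)) P :=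
    hind.comp hf.continuous.measurable hf.continuous.measurable
  -- By independence, `f Y` may be replaced by `f Y - f W`, which is of size `|a|`.
  have hrep : cov[fun ω => f (X ω), fun ω => f (Y ω); P] =
      cov[fun ω => f (X ω), fun ω => f (Y ω) - f (W ω); P] := by
    rw [covariance_fun_sub_right hfX hfY hfW, hfind.covariance_eq_zero hfX hfW, sub_zero]
  have hD : ∀ ω, |f (Y ω) - f (W ω)| ≤
      C * 2 ^ m * |a| * ((1 + |X ω|) ^ (m + 1) * (1 + |W ω|) ^ (2 * m)) := by
    intro ω
    refine (hf.bound _ _).trans ?_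
    have hx := abs_nonneg (X ω)
    have hw := abs_nonneg (W ω)
    have h1 : Y ω - W ω = a * X ω := by simp [hW]
    have h2 : 1 + |Y ω| ≤ 2 * (1 + |X ω|) * (1 + |W ω|) := by
      have : Y ω = a * X ω + W ω := by simp [hW]
      have h3 : |Y ω| ≤ |a| * |X ω| + |W ω| := by
        rw [this, ← abs_mul]; exact abs_add_le _ _
      nlinarith [mul_nonneg hx hw, mul_le_mul_of_nonneg_right ha2 hx]
    rw [h1, abs_mul]
    calc C * (|a| * |X ω|) * ((1 + |Y ω|) * (1 + |W ω|)) ^ m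
        ≤ C * (|a| * (1 + |X ω|)) * ((2 * (1 + |X ω|) * (1 + |W ω|)) * (1 + |W ω|)) ^ m := by
          gcongr
          linarith
      _ = _ := by
          rw [mul_assoc (2 * (1 + |X ω|)), ← sq, mul_pow, mul_pow, ← pow_mul]
          ring
  have hindp : ∀ k l : ℕ, IndepFun (fun ω => (1 + |X ω|) ^ k) (fun ω => (1 + |W ω|) ^ l) P :=
    fun k l => hind.comp (φ := fun x => (1 + |x|) ^ k) (ψ := fun x => (1 + |x|) ^ l)
      (by fun_prop) (by fun_prop)
  have hI : ∀ k l : ℕ, Integrable (fun ω => (1 + |X ω|) ^ k * (1 + |W ω|) ^ l) P := fun k l =>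
    (hindp k l).integrable_mul (hX.integrable_pow hX0 k) (hWG.integrable_pow hW0 l)
  have hE : ∀ k l : ℕ, ∫ ω, (1 + |X ω|) ^ k * (1 + |W ω|) ^ l ∂P =
      (∫ ω, (1 + |X ω|) ^ k ∂P) * ∫ ω, (1 + |W ω|) ^ l ∂P := fun k l =>
    (hindp k l).integral_fun_mul_eq_mul_integral
      (hX.integrable_pow hX0 k).aestronglyMeasurable
      (hWG.integrable_pow hW0 l).aestronglyMeasurable
  set A := |f 0| + C with hA
  have hA0 : 0 ≤ A := by positivity
  set c := C * 2 ^ m * |a| with hc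
  have hc0 : 0 ≤ c := by positivity
  have hXm := fun k => hX.integral_pow_le hX0 hX2 k
  have hWm := fun k => hWG.integral_pow_le hW0 hWv k
  have hX0m : ∀ k : ℕ, 0 ≤ ∫ ω, (1 + |X ω|) ^ k ∂P := fun k =>
    integral_nonneg fun ω => by positivity
  have hW0m : ∀ k : ℕ, 0 ≤ ∫ ω, (1 + |W ω|) ^ k ∂P := fun k =>
    integral_nonneg fun ω => by positivity
  have hg := gaussMoment_nonneg
  have h1 : |∫ ω, f (X ω) * (f (Y ω) - f (W ω)) ∂P| ≤
      A * c * (gaussMoment (m + 1 + (m + 1)) * gaussMoment (2 * m)) := by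
    calc |∫ ω, f (X ω) * (f (Y ω) - f (W ω)) ∂P|
        ≤ ∫ ω, (A * c) * ((1 + |X ω|) ^ (m + 1 + (m + 1)) * (1 + |W ω|) ^ (2 * m)) ∂P := by
          refine abs_integral_le_of_abs_le ((hI _ _).const_mul _) fun ω => ?_
          rw [abs_mul]
          calc _ ≤ (A * (1 + |X ω|) ^ (m + 1)) *
                (c * ((1 + |X ω|) ^ (m + 1) * (1 + |W ω|) ^ (2 * m))) :=
                mul_le_mul (hf.growth _) (hD ω) (abs_nonneg _) (by positivity)
            _ = _ := by ring
      _ ≤ _ := by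
          rw [integral_const_mul, hE]
          have := hg (m + 1 + (m + 1))
          gcongr
          exacts [hXm _, hWm _]
  have h2 : |∫ ω, f (X ω) ∂P| ≤ A * gaussMoment (m + 1) := by
    calc |∫ ω, f (X ω) ∂P| ≤ ∫ ω, A * (1 + |X ω|) ^ (m + 1) ∂P :=
          abs_integral_le_of_abs_le ((hX.integrable_pow hX0 _).const_mul _) fun ω => hf.growth _
      _ ≤ _ := by
          rw [integral_const_mul]
          gcongr
          exact hXm _
  have h3 : |∫ ω, (f (Y ω) - f (W ω)) ∂P| ≤
      c * (gaussMoment (m + 1) * gaussMoment (2 * m)) := by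
    calc |∫ ω, (f (Y ω) - f (W ω)) ∂P|
        ≤ ∫ ω, c * ((1 + |X ω|) ^ (m + 1) * (1 + |W ω|) ^ (2 * m)) ∂P :=
          abs_integral_le_of_abs_le ((hI _ _).const_mul _) hD
      _ ≤ _ := by
          rw [integral_const_mul, hE]
          have := hg (m + 1)
          gcongr
          exacts [hXm _, hWm _]
  have h4 : |cov[fun ω => f (X ω), fun ω => f (Y ω); P]| ≤ A * c *
      (gaussMoment (m + 1 + (m + 1)) * gaussMoment (2 * m) +
        gaussMoment (m + 1) * (gaussMoment (m + 1) * gaussMoment (2 * m))) := by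
    have hcs := covariance_eq_sub hfX (hfY.sub hfW)
    simp only [Pi.mul_def, Pi.sub_def] at hcs
    rw [hrep, hcs]
    calc _ ≤ |∫ ω, f (X ω) * (f (Y ω) - f (W ω)) ∂P| +
          |∫ ω, f (X ω) ∂P| * |∫ ω, (f (Y ω) - f (W ω)) ∂P| := by
          rw [← abs_mul]
          exact abs_sub _ _
      _ ≤ A * c * (gaussMoment (m + 1 + (m + 1)) * gaussMoment (2 * m)) +
          (A * gaussMoment (m + 1)) * (c * (gaussMoment (m + 1) * gaussMoment (2 * m))) := by
          have := hg (m + 1)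
          gcongr
      _ = _ := by ring
  refine h4.trans ?_
  set G := gaussMoment (m + 1 + (m + 1)) * gaussMoment (2 * m) +
        gaussMoment (m + 1) * (gaussMoment (m + 1) * gaussMoment (2 * m)) with hG
  have hG0 : 0 ≤ G := by
    have h5 := hg (m + 1)
    have h6 := hg (2 * m)
    have h7 := hg (m + 1 + (m + 1))
    positivity
  calc A * c * G = A * (C * 2 ^ m) * G * |a| := by rw [hc]; ring
    _ ≤ A * (C * 2 ^ m) * G * (2 * |cov[X, Y; P]|) := by gcongr
    _ = _ := by ring

end RandomVariable

/-! ### Mixed second differences -/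

/-- The mixed second difference
`G(s + ε, t + ε) - G(s + ε, t) - G(s, t + ε) + G(s, t)` of a function of two variables. -/
def mixedDiff (G : ℝ → ℝ → ℝ) (ε s t : ℝ) : ℝ :=
  G (s + ε) (t + ε) - G (s + ε) t - G s (t + ε) + G s t

/-- The mean value inequality, applied once in each variable. -/
lemma abs_mixedDiff_le {G G₁ G₂ : ℝ → ℝ → ℝ} {ε s t M : ℝ} (hε : 0 ≤ ε)
    (h₁ : ∀ x ∈ Set.Icc s (s + ε), ∀ y ∈ Set.Icc t (t + ε),
      HasDerivAt (fun x => G x y) (G₁ x y) x)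
    (h₂ : ∀ x ∈ Set.Icc s (s + ε), ∀ y ∈ Set.Icc t (t + ε),
      HasDerivAt (fun y => G₁ x y) (G₂ x y) y)
    (hM : ∀ x ∈ Set.Icc s (s + ε), ∀ y ∈ Set.Icc t (t + ε), |G₂ x y| ≤ M) :
    |mixedDiff G ε s t| ≤ M * ε ^ 2 := by
  have hs : s ∈ Set.Icc s (s + ε) := ⟨le_rfl, by linarith⟩
  have hs' : s + ε ∈ Set.Icc s (s + ε) := ⟨by linarith, le_rfl⟩
  have ht : t ∈ Set.Icc t (t + ε) := ⟨le_rfl, by linarith⟩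
  have ht' : t + ε ∈ Set.Icc t (t + ε) := ⟨by linarith, le_rfl⟩
  have h3 : ∀ x ∈ Set.Icc s (s + ε), |G₁ x (t + ε) - G₁ x t| ≤ M * ε := by
    intro x hx
    have := (convex_Icc t (t + ε)).norm_image_sub_le_of_norm_hasDerivWithin_le
      (f := fun y => G₁ x y) (fun y hy => (h₂ x hx y hy).hasDerivWithinAt)
      (fun y hy => hM x hx y hy) ht ht'
    simpa [abs_of_nonneg hε] using this
  have := (convex_Icc s (s + ε)).norm_image_sub_le_of_norm_hasDerivWithin_le
    (f := fun x => G x (t + ε) - G x t)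
    (fun x hx => ((h₁ x hx _ ht').sub (h₁ x hx _ ht)).hasDerivWithinAt) h3 hs hs'
  simp only [Real.norm_eq_abs, add_sub_cancel_left, abs_of_nonneg hε] at this
  rw [mixedDiff, sq, ← mul_assoc]
  convert this using 2
  ring

lemma abs_mixedDiff_rpow_add_rpow_le {a K ε η s t : ℝ} (ha : a ∈ Set.Ioo (0 : ℝ) 2)
    (hK : K ∈ Set.Ioc (0 : ℝ) 1) (hε : ε ∈ Set.Icc (0 : ℝ) 1) (hη : 0 < η)
    (hs : s ∈ Set.Icc η 1) (ht : t ∈ Set.Icc η 1) :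
    |mixedDiff (fun x y => (y ^ a + x ^ a) ^ K) ε s t| ≤ 16 * η⁻¹ ^ 6 * ε ^ 2 := by
  obtain ⟨ha0, ha2⟩ := ha
  obtain ⟨hK0, hK1⟩ := hK
  have hη1 : η ≤ 1 := hs.1.trans hs.2
  have hmem : ∀ {u x : ℝ}, u ∈ Set.Icc η 1 → x ∈ Set.Icc u (u + ε) → η ≤ x ∧ x ≤ 2 :=
    fun hu hx => ⟨hu.1.trans hx.1, by linarith [hx.2, hu.2, hε.2]⟩
  refine abs_mixedDiff_le (G₁ := fun x y => (a * x ^ (a - 1)) * K * (y ^ a + x ^ a) ^ (K - 1))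
    (G₂ := fun x y => (a * x ^ (a - 1)) * K *
      ((a * y ^ (a - 1)) * (K - 1) * (y ^ a + x ^ a) ^ (K - 1 - 1))) hε.1 ?_ ?_ ?_
  · intro x hx y hy
    have hx0 : 0 < x := hη.trans_le (hmem hs hx).1
    have hy0 : 0 < y := hη.trans_le (hmem ht hy).1
    have : 0 < y ^ a + x ^ a := by positivity
    exact ((Real.hasDerivAt_rpow_const (Or.inl hx0.ne')).const_add (y ^ a)).rpow_const
      (Or.inl this.ne')
  · intro x hx y hy
    have hx0 : 0 < x := hη.trans_le (hmem hs hx).1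
    have hy0 : 0 < y := hη.trans_le (hmem ht hy).1
    have : 0 < y ^ a + x ^ a := by positivity
    exact (((Real.hasDerivAt_rpow_const (Or.inl hy0.ne')).add_const (x ^ a)).rpow_const
      (Or.inl this.ne')).const_mul _
  · intro x hx y hy
    have hb : ∀ z, η ≤ z → z ≤ 2 → z ^ (a - 1) ≤ 2 * η⁻¹ := by
      intro z hz hz2
      have hz0 : 0 < z := hη.trans_le hz
      have h1 : 1 ≤ η⁻¹ := one_le_inv₀ hη |>.2 hη1
      rcases le_total z 1 with h | h
      · calc z ^ (a - 1) ≤ z ^ (-1 : ℝ) :=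
              Real.rpow_le_rpow_of_exponent_ge hz0 h (by linarith)
          _ = z⁻¹ := Real.rpow_neg_one z
          _ ≤ η⁻¹ := inv_anti₀ hη hz
          _ ≤ _ := by linarith
      · calc z ^ (a - 1) ≤ z ^ (1 : ℝ) :=
              Real.rpow_le_rpow_of_exponent_le h (by linarith)
          _ = z := Real.rpow_one z
          _ ≤ _ := by linarith
    obtain ⟨hx1, hx2⟩ := hmem hs hx
    obtain ⟨hy1, hy2⟩ := hmem ht hy
    have hx0 : 0 < x := hη.trans_le hx1
    have hy0 : 0 < y := hη.trans_le hy1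
    have hS : (y ^ a + x ^ a) ^ (K - 1 - 1) ≤ η⁻¹ ^ 4 := by
      calc (y ^ a + x ^ a) ^ (K - 1 - 1) ≤ (η ^ a) ^ (K - 1 - 1) := by
            apply Real.rpow_le_rpow_of_nonpos (by positivity) _ (by linarith)
            have := Real.rpow_le_rpow hη.le hx1 ha0.le
            have : 0 ≤ y ^ a := by positivity
            linarith
        _ = η ^ (a * (K - 1 - 1)) := (Real.rpow_mul hη.le _ _).symm
        _ ≤ η ^ (-4 : ℝ) := by
            apply Real.rpow_le_rpow_of_exponent_ge hη hη1
            nlinarith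
        _ = η⁻¹ ^ 4 := by
            rw [Real.rpow_neg hη.le, inv_pow]
            norm_cast
    have hx3 := hb x hx1 hx2
    have hy3 := hb y hy1 hy2
    have hxa : |a * x ^ (a - 1)| ≤ 2 * (2 * η⁻¹) := by
      rw [abs_of_nonneg (by positivity)]
      gcongr
    have hya : |a * y ^ (a - 1)| ≤ 2 * (2 * η⁻¹) := by
      rw [abs_of_nonneg (by positivity)]
      gcongr
    have hSa : |(y ^ a + x ^ a) ^ (K - 1 - 1)| ≤ η⁻¹ ^ 4 := by
      rwa [abs_of_nonneg (by positivity)]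
    have hKa : |K| ≤ 1 := by rw [abs_le]; constructor <;> linarith
    have hK1a : |K - 1| ≤ 1 := by rw [abs_le]; constructor <;> linarith
    have hη' : 0 < η⁻¹ := inv_pos.2 hη
    simp only [abs_mul (a * x ^ (a - 1) * K), abs_mul (a * x ^ (a - 1)),
      abs_mul (a * y ^ (a - 1) * (K - 1)), abs_mul (a * y ^ (a - 1))]
    calc _ ≤ (2 * (2 * η⁻¹)) * 1 * ((2 * (2 * η⁻¹)) * 1 * η⁻¹ ^ 4) := by gcongr
      _ = _ := by ring

lemma mixedDiff_abs_rpow_self {b : ℝ} (hb : 0 < b) {ε : ℝ} (hε : 0 ≤ ε) (t : ℝ) :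
    mixedDiff (fun x y => |y - x| ^ b) ε t t = - (2 * ε ^ b) := by
  simp [mixedDiff, hb.ne', abs_of_nonneg hε]
  ring

lemma abs_mixedDiff_abs_rpow_le {b ε η s t : ℝ} (hb : b ∈ Set.Ioo (0 : ℝ) 2) (hε : 0 ≤ ε)
    (hη : 0 < η) (hεη : 2 * ε ≤ η) (hst : s + η ≤ t) (h1 : t - s ≤ 1) :
    |mixedDiff (fun x y => |y - x| ^ b) ε s t| ≤ 8 * η⁻¹ ^ 6 * ε ^ 2 := by
  obtain ⟨hb0, hb2⟩ := hb
  have hη1 : η ≤ 1 := by linarith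
  have hmem : ∀ {x y}, x ∈ Set.Icc s (s + ε) → y ∈ Set.Icc t (t + ε) → η / 2 ≤ y - x :=
    fun hx hy => by linarith [hx.2, hy.1]
  have heq : mixedDiff (fun x y => |y - x| ^ b) ε s t =
      mixedDiff (fun x y => (y - x) ^ b) ε s t := by
    simp only [mixedDiff]
    rw [abs_of_nonneg, abs_of_nonneg, abs_of_nonneg, abs_of_nonneg] <;> linarith
  rw [heq]
  refine abs_mixedDiff_le (G₁ := fun x y => (-1) * b * (y - x) ^ (b - 1))
    (G₂ := fun x y => (-1) * b * (1 * (b - 1) * (y - x) ^ (b - 1 - 1))) hε ?_ ?_ ?_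
  · intro x hx y hy
    have := hmem hx hy
    exact ((hasDerivAt_id x).const_sub y).rpow_const (Or.inl (by simp; linarith))
  · intro x hx y hy
    have := hmem hx hy
    exact (((hasDerivAt_id y).sub_const x).rpow_const (Or.inl (by simp; linarith))).const_mul _
  · intro x hx y hy
    have h := hmem hx hy
    have hp : (y - x) ^ (b - 1 - 1) ≤ 4 * η⁻¹ ^ 6 := by
      calc (y - x) ^ (b - 1 - 1) ≤ (η / 2) ^ (b - 1 - 1) :=
            Real.rpow_le_rpow_of_nonpos (by positivity) h (by linarith)
        _ ≤ (η / 2) ^ (-2 : ℝ) :=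
            Real.rpow_le_rpow_of_exponent_ge (by positivity) (by linarith) (by linarith)
        _ = 4 * η⁻¹ ^ 2 := by
            rw [Real.rpow_neg (by positivity)]
            norm_cast
            field_simp
            norm_num
        _ ≤ _ := by
            have : 1 ≤ η⁻¹ := one_le_inv₀ hη |>.2 hη1
            gcongr
            norm_num
    have hb1 : |b - 1| ≤ 1 := by rw [abs_le]; constructor <;> linarith
    have h0 : 0 ≤ (y - x) ^ (b - 1 - 1) := Real.rpow_nonneg (by linarith) _
    rw [abs_mul, abs_mul, abs_mul, abs_mul]
    simp only [abs_neg, abs_one, one_mul, abs_of_pos hb0, abs_of_nonneg h0]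
    calc b * (|b - 1| * (y - x) ^ (b - 1 - 1)) ≤ 2 * (1 * (4 * η⁻¹ ^ 6)) := by gcongr
      _ = _ := by ring

/-- Midpoint concavity of `x ↦ x ^ K` at `2 (t + ε) ^ a` and `2 t ^ a`. It gives the bound
`Var (B t - B s) ≤ 2 ^ (1 - K) |t - s| ^ (2HK)` for bifractional Brownian motion. -/
lemma mixedDiff_rpow_add_rpow_self_nonpos {a K ε t : ℝ} (hK : K ∈ Set.Ioc (0 : ℝ) 1)
    (hε : 0 ≤ ε) (ht : 0 ≤ t) :
    mixedDiff (fun x y => (y ^ a + x ^ a) ^ K) ε t t ≤ 0 := by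
  have h := @(Real.concaveOn_rpow hK.1.le hK.2).2
    ((t + ε) ^ a + (t + ε) ^ a) (by simp only [Set.mem_Ici]; positivity)
    (t ^ a + t ^ a) (by simp only [Set.mem_Ici]; positivity)
    (1 / 2) (1 / 2) (by norm_num) (by norm_num) (by norm_num)
  simp only [smul_eq_mul] at h
  have e : 1 / 2 * ((t + ε) ^ a + (t + ε) ^ a) + 1 / 2 * (t ^ a + t ^ a) =
    (t + ε) ^ a + t ^ a := by ring
  rw [e] at h
  simp only [mixedDiff]
  rw [add_comm (t ^ a) ((t + ε) ^ a)]
  linarith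

/-! ### Covariances of the normalized increments -/

lemma abs_covariance_le {Ω : Type*} [MeasurableSpace Ω] {P : Measure Ω} [IsFiniteMeasure P]
    {U V : Ω → ℝ} (hU : MemLp U 2 P) (hV : MemLp V 2 P) :
    |cov[U, V; P]| ≤ (Var[U; P] + Var[V; P]) / 2 := by
  have hU' : MemLp (fun ω => U ω - ∫ x, U x ∂P) 2 P := hU.sub (memLp_const _)
  have hV' : MemLp (fun ω => V ω - ∫ x, V x ∂P) 2 P := hV.sub (memLp_const _)
  rw [variance_eq_integral hU.aemeasurable, variance_eq_integral hV.aemeasurable,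
    ← integral_add hU'.integrable_sq hV'.integrable_sq, ← integral_div, covariance]
  refine abs_integral_le_of_abs_le ((hU'.integrable_sq.add hV'.integrable_sq).div_const 2)
    fun ω => ?_
  rw [abs_mul, ← sq_abs (U ω - _), ← sq_abs (V ω - _)]
  nlinarith [sq_nonneg (|U ω - ∫ x, U x ∂P| - |V ω - ∫ x, V x ∂P|)]

lemma tendsto_rpow_nhdsGT_zero {a : ℝ} (ha : 0 < a) :
    Tendsto (fun ε : ℝ => ε ^ a) (𝓝[>] 0) (𝓝 0) := by
  have h := (Real.continuousAt_rpow_const 0 a (Or.inr ha.le)).tendsto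
  rw [Real.zero_rpow ha.ne'] at h
  exact h.mono_left nhdsWithin_le_nhds

lemma bifBmZ_eq_mul {Ω : Type*} (H K : ℝ) (B : ℝ≥0 → Ω → ℝ) (ε t : ℝ) :
    bifBmZ H K B ε t = fun ω => (ε ^ (H * K))⁻¹ * (B (t + ε).toNNReal ω - B t.toNNReal ω) := by
  ext ω
  simp [bifBmZ, div_eq_inv_mul]

namespace IsBifBm

variable {Ω : Type*} [MeasurableSpace Ω] {P : Measure Ω} {H K : ℝ} {B : ℝ≥0 → Ω → ℝ}

lemma hasGaussianLaw_sub (hB : IsBifBm H K B P) (s t : ℝ≥0) :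
    HasGaussianLaw (fun ω => B t ω - B s ω) P :=
  hB.isGaussianProcess.hasGaussianLaw_fun_sub

lemma memLp_two (hB : IsBifBm H K B P) (t : ℝ≥0) : MemLp (B t) 2 P :=
  (hB.isGaussianProcess.hasGaussianLaw_eval t).memLp_two

lemma integral_sub_eq_zero (hB : IsBifBm H K B P) (s t : ℝ≥0) :
    ∫ ω, (B t ω - B s ω) ∂P = 0 := by
  rw [integral_sub (hB.isGaussianProcess.hasGaussianLaw_eval t).integrable
    (hB.isGaussianProcess.hasGaussianLaw_eval s).integrable, hB.centered, hB.centered, sub_zero]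

lemma cov_increments [IsProbabilityMeasure P] (hB : IsBifBm H K B P) {ε s t : ℝ} (hε : 0 ≤ ε)
    (hs : 0 ≤ s) (ht : 0 ≤ t) :
    cov[fun ω => B (s + ε).toNNReal ω - B s.toNNReal ω,
      fun ω => B (t + ε).toNNReal ω - B t.toNNReal ω; P] =
      1 / 2 ^ K * (mixedDiff (fun x y => (y ^ (2 * H) + x ^ (2 * H)) ^ K) ε s t -
        mixedDiff (fun x y => |y - x| ^ (2 * H * K)) ε s t) := by
  rw [covariance_fun_sub_fun_sub (hB.memLp_two _) (hB.memLp_two _) (hB.memLp_two _)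
    (hB.memLp_two _)]
  simp only [hB.covariance_eq, bifBmCov, mixedDiff, Real.coe_toNNReal _ hs,
    Real.coe_toNNReal _ ht, Real.coe_toNNReal _ (add_nonneg hs hε),
    Real.coe_toNNReal _ (add_nonneg ht hε)]
  ring

/-- The leading term comes from the diagonal value `-2 ε ^ (2HK)` of the mixed difference of
`|t - s| ^ (2HK)`; the rest is of order `ε ^ 2` away from the time origin. -/
lemma var_increment [IsProbabilityMeasure P] (hB : IsBifBm H K B P) (hH : H ∈ Set.Ioo (0 : ℝ) 1)
    (hK : K ∈ Set.Ioc (0 : ℝ) 1) {ε t : ℝ} (hε : 0 ≤ ε) (ht : 0 ≤ t) :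
    Var[fun ω => B (t + ε).toNNReal ω - B t.toNNReal ω; P] = 2 ^ (1 - K) * ε ^ (2 * H * K) +
      1 / 2 ^ K * mixedDiff (fun x y => (y ^ (2 * H) + x ^ (2 * H)) ^ K) ε t t := by
  have hb : 0 < 2 * H * K := mul_pos (mul_pos two_pos hH.1) hK.1
  rw [← covariance_self (hB.hasGaussianLaw_sub _ _).aemeasurable, hB.cov_increments hε ht ht,
    mixedDiff_abs_rpow_self hb hε, Real.rpow_sub two_pos, Real.rpow_one]
  ring

lemma var_sub_le [IsProbabilityMeasure P] (hB : IsBifBm H K B P) (hH : H ∈ Set.Ioo (0 : ℝ) 1)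
    (hK : K ∈ Set.Ioc (0 : ℝ) 1) (s t : ℝ≥0) :
    Var[fun ω => B t ω - B s ω; P] ≤ 2 * |(t : ℝ) - s| ^ (2 * H * K) := by
  wlog hst : s ≤ t generalizing s t
  · have h := this t s (le_of_not_ge hst)
    rw [abs_sub_comm]
    convert h using 1
    rw [← variance_fun_neg]
    simp
  have hst' : (s : ℝ) ≤ t := hst
  have hv := hB.var_increment hH hK (ε := t - s) (t := s) (sub_nonneg.2 hst') s.2
  rw [add_sub_cancel, Real.toNNReal_coe, Real.toNNReal_coe] at hv
  rw [hv, abs_of_nonneg (sub_nonneg.2 hst')]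
  have h1 := mixedDiff_rpow_add_rpow_self_nonpos (a := 2 * H) hK (sub_nonneg.2 hst') s.2
  have h2 : (2 : ℝ) ^ (1 - K) ≤ 2 := by
    calc (2 : ℝ) ^ (1 - K) ≤ 2 ^ (1 : ℝ) :=
          Real.rpow_le_rpow_of_exponent_le one_le_two (by linarith [hK.1])
      _ = 2 := Real.rpow_one 2
  have h3 : 0 ≤ ((t : ℝ) - s) ^ (2 * H * K) := Real.rpow_nonneg (sub_nonneg.2 hst') _
  have h4 := mul_nonpos_of_nonneg_of_nonpos (a := (1 : ℝ) / 2 ^ K) (by positivity) h1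
  have h5 := mul_le_mul_of_nonneg_right h2 h3
  exact (add_le_of_nonpos_right h4).trans h5

lemma hasGaussianLaw_Z (hB : IsBifBm H K B P) (ε t : ℝ) :
    HasGaussianLaw (bifBmZ H K B ε t) P := by
  have h := (hB.hasGaussianLaw_sub t.toNNReal (t + ε).toNNReal).fun_smul (ε ^ (H * K))⁻¹
  refine h.congr (ae_of_all _ fun ω => ?_)
  simp [bifBmZ, div_eq_inv_mul]

lemma integral_Z (hB : IsBifBm H K B P) (ε t : ℝ) : ∫ ω, bifBmZ H K B ε t ω ∂P = 0 := by
  simp only [bifBmZ]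
  rw [integral_div, hB.integral_sub_eq_zero, zero_div]

lemma hasGaussianLaw_Z_prodMk (hB : IsBifBm H K B P) (ε s t : ℝ) :
    HasGaussianLaw (fun ω => (bifBmZ H K B ε s ω, bifBmZ H K B ε t ω)) P := by
  classical
  have h1 : IsGaussianProcess (fun (t : ℝ) (ω : Ω) => bifBmZ H K B ε t ω) P := by
    refine hB.isGaussianProcess.of_isGaussianProcess fun t => ?_
    refine ⟨{t.toNNReal, (t + ε).toNNReal}, (ε ^ (H * K))⁻¹ •
      (ContinuousLinearMap.proj (R := ℝ) (φ := fun _ => ℝ)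
        (⟨(t + ε).toNNReal, by simp⟩ : ({t.toNNReal, (t + ε).toNNReal} : Finset ℝ≥0)) -
      ContinuousLinearMap.proj (R := ℝ) (φ := fun _ => ℝ)
        (⟨t.toNNReal, by simp⟩ : ({t.toNNReal, (t + ε).toNNReal} : Finset ℝ≥0))), fun ω => ?_⟩
    simp [bifBmZ, div_eq_inv_mul]
  exact h1.hasGaussianLaw_prodMk

lemma sq_rpow_HK {ε : ℝ} (hε : 0 < ε) : ε ^ (H * K) * ε ^ (H * K) = ε ^ (2 * H * K) := by
  rw [← Real.rpow_add hε]
  ring_nf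

lemma var_Z_le [IsProbabilityMeasure P] (hB : IsBifBm H K B P) (hH : H ∈ Set.Ioo (0 : ℝ) 1)
    (hK : K ∈ Set.Ioc (0 : ℝ) 1) {ε : ℝ} (hε : 0 < ε) (t : ℝ) :
    Var[bifBmZ H K B ε t; P] ≤ 2 := by
  have hb : 0 < 2 * H * K := mul_pos (mul_pos two_pos hH.1) hK.1
  have h := hB.var_sub_le hH hK t.toNNReal (t + ε).toNNReal
  have h1 : |((t + ε).toNNReal : ℝ) - t.toNNReal| ≤ ε := by
    simp only [Real.coe_toNNReal']
    have := abs_max_sub_max_le_abs (t + ε) t 0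
    rwa [add_sub_cancel_left, abs_of_pos hε] at this
  have h2 := Real.rpow_le_rpow (abs_nonneg _) h1 hb.le
  have h3 : 0 < ε ^ (H * K) := by positivity
  rw [bifBmZ_eq_mul, variance_const_mul, inv_pow, inv_mul_le_iff₀ (by positivity), sq,
    sq_rpow_HK hε]
  linarith

lemma var_Z_sub [IsProbabilityMeasure P] (hB : IsBifBm H K B P) (hH : H ∈ Set.Ioo (0 : ℝ) 1)
    (hK : K ∈ Set.Ioc (0 : ℝ) 1) {ε η t : ℝ} (hε : ε ∈ Set.Ioc (0 : ℝ) 1) (hη : 0 < η)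
    (ht : t ∈ Set.Icc η 1) :
    |Var[bifBmZ H K B ε t; P] - 2 ^ (1 - K)| ≤ 16 * η⁻¹ ^ 6 * ε ^ (2 - 2 * H * K) := by
  have hε0 := hε.1
  have h3 : 0 < ε ^ (2 * H * K) := by positivity
  have h4 := abs_mixedDiff_rpow_add_rpow_le (a := 2 * H) ⟨by linarith [hH.1], by linarith [hH.2]⟩
    hK ⟨hε0.le, hε.2⟩ hη ht ht
  rw [bifBmZ_eq_mul, variance_const_mul, inv_pow, sq, sq_rpow_HK hε0,
    hB.var_increment hH hK hε0.le (hη.le.trans ht.1)]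
  set D := mixedDiff (fun x y => (y ^ (2 * H) + x ^ (2 * H)) ^ K) ε t t
  have h5 : (ε ^ (2 * H * K))⁻¹ * (2 ^ (1 - K) * ε ^ (2 * H * K) + 1 / 2 ^ K * D) - 2 ^ (1 - K) =
      (ε ^ (2 * H * K))⁻¹ * (1 / 2 ^ K) * D := by field_simp; ring
  have h6 : (1 : ℝ) / 2 ^ K ≤ 1 := by
    rw [div_le_one (by positivity)]
    exact Real.one_le_rpow one_le_two hK.1.le
  have h7 : ε ^ (2 - 2 * H * K) = (ε ^ (2 * H * K))⁻¹ * ε ^ 2 := by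
    rw [Real.rpow_sub hε0, div_eq_inv_mul]
    norm_cast
  rw [h5, abs_mul, abs_of_nonneg (by positivity), h7]
  calc (ε ^ (2 * H * K))⁻¹ * (1 / 2 ^ K) * |D|
      ≤ (ε ^ (2 * H * K))⁻¹ * 1 * (16 * η⁻¹ ^ 6 * ε ^ 2) := by gcongr
    _ = _ := by ring

lemma cov_Z_le [IsProbabilityMeasure P] (hB : IsBifBm H K B P) (hH : H ∈ Set.Ioo (0 : ℝ) 1)
    (hK : K ∈ Set.Ioc (0 : ℝ) 1) {ε η s t : ℝ} (hε : ε ∈ Set.Ioc (0 : ℝ) 1) (hη : 0 < η)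
    (hεη : 2 * ε ≤ η) (hs : s ∈ Set.Icc η 1) (ht : t ∈ Set.Icc η 1) (hst : η ≤ |t - s|) :
    |cov[bifBmZ H K B ε s, bifBmZ H K B ε t; P]| ≤ 24 * η⁻¹ ^ 6 * ε ^ (2 - 2 * H * K) := by
  wlog hle : s ≤ t generalizing s t
  · rw [covariance_comm]
    exact this ht hs (by rwa [abs_sub_comm]) (le_of_not_ge hle)
  rw [abs_of_nonneg (sub_nonneg.2 hle)] at hst
  have hε0 := hε.1
  have h3 : 0 < ε ^ (2 * H * K) := by positivity
  have h4 := abs_mixedDiff_rpow_add_rpow_le (a := 2 * H) ⟨by linarith [hH.1], by linarith [hH.2]⟩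
    hK ⟨hε0.le, hε.2⟩ hη hs ht
  have hb : 2 * H * K ∈ Set.Ioo (0 : ℝ) 2 :=
    ⟨mul_pos (mul_pos two_pos hH.1) hK.1, by nlinarith [hH.1, hH.2, hK.1, hK.2]⟩
  have h5 := abs_mixedDiff_abs_rpow_le hb hε0.le hη hεη (s := s) (t := t) (by linarith)
    (by linarith [ht.2, hs.1])
  rw [bifBmZ_eq_mul, bifBmZ_eq_mul, covariance_const_mul_left, covariance_const_mul_right,
    ← mul_assoc, ← mul_inv, sq_rpow_HK hε0,
    hB.cov_increments hε0.le (hη.le.trans hs.1) (hη.le.trans ht.1)]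
  set D := mixedDiff (fun x y => (y ^ (2 * H) + x ^ (2 * H)) ^ K) ε s t
  set E := mixedDiff (fun x y => |y - x| ^ (2 * H * K)) ε s t
  have h6 : (1 : ℝ) / 2 ^ K ≤ 1 := by
    rw [div_le_one (by positivity)]
    exact Real.one_le_rpow one_le_two hK.1.le
  have h7 : ε ^ (2 - 2 * H * K) = (ε ^ (2 * H * K))⁻¹ * ε ^ 2 := by
    rw [Real.rpow_sub hε0, div_eq_inv_mul]
    norm_cast
  have h8 : |D - E| ≤ 16 * η⁻¹ ^ 6 * ε ^ 2 + 8 * η⁻¹ ^ 6 * ε ^ 2 :=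
    (abs_sub _ _).trans (add_le_add h4 h5)
  rw [← mul_assoc, abs_mul, abs_of_nonneg (by positivity), h7]
  calc (ε ^ (2 * H * K))⁻¹ * (1 / 2 ^ K) * |D - E|
      ≤ (ε ^ (2 * H * K))⁻¹ * 1 * (16 * η⁻¹ ^ 6 * ε ^ 2 + 8 * η⁻¹ ^ 6 * ε ^ 2) := by gcongr
    _ = _ := by ring

lemma var_comp_Z_le [IsProbabilityMeasure P] (hB : IsBifBm H K B P)
    (hH : H ∈ Set.Ioo (0 : ℝ) 1) (hK : K ∈ Set.Ioc (0 : ℝ) 1) {f : ℝ → ℝ} {C : ℝ} {m : ℕ}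
    (hf : PolyLip f C m) {ε : ℝ} (hε : 0 < ε) (t : ℝ) :
    Var[fun ω => f (bifBmZ H K B ε t ω); P] ≤ (|f 0| + C) ^ 2 * gaussMoment ((m + 1) * 2) := by
  have hG := hB.hasGaussianLaw_Z ε t
  refine (variance_le_expectation_sq
    (hf.memLp_two_comp hG (hB.integral_Z ε t)).aestronglyMeasurable).trans ?_
  exact hf.integral_sq_comp_le hG (hB.integral_Z ε t) (hB.var_Z_le hH hK hε t)

/-- Decorrelation of `f (Z_ε(s))` and `f (Z_ε(t))`, with a constant depending on `f` only, when
`s` and `t` stay at distance at least `η` from the time origin and from one another. -/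
lemma exists_cov_comp_Z_le [IsProbabilityMeasure P] (hB : IsBifBm H K B P)
    (hH : H ∈ Set.Ioo (0 : ℝ) 1) (hK : K ∈ Set.Ioc (0 : ℝ) 1) {f : ℝ → ℝ} {C : ℝ} {m : ℕ}
    (hf : PolyLip f C m) :
    ∃ D, 0 ≤ D ∧ (∀ ε s t : ℝ, 0 < ε →
        |cov[fun ω => f (bifBmZ H K B ε s ω), fun ω => f (bifBmZ H K B ε t ω); P]| ≤ D) ∧
      ∀ ε η s t : ℝ, ε ∈ Set.Ioc (0 : ℝ) 1 → 0 < η → 2 * ε ≤ η → s ∈ Set.Icc η 1 →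
        t ∈ Set.Icc η 1 → η ≤ |t - s| →
        |cov[fun ω => f (bifBmZ H K B ε s ω), fun ω => f (bifBmZ H K B ε t ω); P]| ≤
          D * (η⁻¹ ^ 6 * ε ^ (2 - 2 * H * K)) := by
  set M := (|f 0| + C) ^ 2 * gaussMoment ((m + 1) * 2) with hM
  have hg := gaussMoment_nonneg
  have hC := hf.nonneg
  have hM0 : 0 ≤ M := mul_nonneg (sq_nonneg _) (hg _)
  set A := (|f 0| + C) * (2 * C * 2 ^ m) * (gaussMoment (m + 1 + (m + 1)) * gaussMoment (2 * m) +
        gaussMoment (m + 1) * (gaussMoment (m + 1) * gaussMoment (2 * m))) with hA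
  have hA0 : 0 ≤ A := by
    have h5 := hg (m + 1)
    have h6 := hg (2 * m)
    have h7 := hg (m + 1 + (m + 1))
    positivity
  have hcrude : ∀ ε s t : ℝ, 0 < ε →
      |cov[fun ω => f (bifBmZ H K B ε s ω), fun ω => f (bifBmZ H K B ε t ω); P]| ≤ M := by
    intro ε s t hε
    have h := abs_covariance_le (hf.memLp_two_comp (hB.hasGaussianLaw_Z ε s) (hB.integral_Z ε s))
      (hf.memLp_two_comp (hB.hasGaussianLaw_Z ε t) (hB.integral_Z ε t))
    have h1 := hB.var_comp_Z_le hH hK hf hε s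
    have h2 := hB.var_comp_Z_le hH hK hf hε t
    linarith
  refine ⟨32 * M + 24 * A, by positivity, fun ε s t hε => (hcrude ε s t hε).trans (by linarith),
    fun ε η s t hε hη hεη hs ht hst => ?_⟩
  have hε0 := hε.1
  set r := η⁻¹ ^ 6 * ε ^ (2 - 2 * H * K) with hr
  have hr0 : 0 ≤ r := by positivity
  -- If `r ≥ 1 / 32` the crude bound suffices. Otherwise `Var Z_ε(s) ≥ 2 ^ (1 - K) - 16 r ≥ 1 / 2`,
  -- as the linear bound on the covariance of functions of Gaussian variables demands.
  rcases le_total (1 / 32) r with h | h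
  · refine (hcrude ε s t hε0).trans ?_
    nlinarith [mul_nonneg hA0 hr0]
  · have hv := hB.var_Z_sub hH hK hε hη hs
    rw [mul_assoc, ← hr] at hv
    have h1 : (1 : ℝ) ≤ 2 ^ (1 - K) := Real.one_le_rpow one_le_two (by linarith [hK.2])
    have hv1 : 1 / 2 ≤ Var[bifBmZ H K B ε s; P] := by linarith [(abs_le.1 hv).1]
    have hcov := hf.abs_cov_comp_le (hB.hasGaussianLaw_Z_prodMk ε s t) (hB.integral_Z ε s)
      (hB.integral_Z ε t) (hB.var_Z_le hH hK hε0 s) (hB.var_Z_le hH hK hε0 t) hv1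
    have hcZ := hB.cov_Z_le hH hK hε hη hεη hs ht hst
    rw [mul_assoc, ← hr] at hcZ
    calc _ ≤ A * |cov[bifBmZ H K B ε s, bifBmZ H K B ε t; P]| := hcov
      _ ≤ A * (24 * r) := by gcongr
      _ ≤ _ := by nlinarith [mul_nonneg hM0 hr0]

end IsBifBm

/-! ### Mean and variance of the averages -/

section SecondMoment

variable {Ω : Type*} [MeasurableSpace Ω] {P : Measure Ω} [IsProbabilityMeasure P]

/-- The variance of `∫ F t dμ(t)` is the double integral of the covariances of `F`. -/
lemma lintegral_sq_integral_sub_le {T : Type*} [MeasurableSpace T] {μ : Measure T}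
    [IsFiniteMeasure μ] {F : T → Ω → ℝ}
    (hF : Measurable (Function.uncurry F)) (hL : ∀ t, MemLp (F t) 2 P) {M : ℝ}
    (hM : ∀ t, Var[F t; P] ≤ M) {b : ℝ}
    (hb : ∫ p, |cov[F p.1, F p.2; P]| ∂(μ.prod μ) ≤ b) :
    ∫⁻ ω, ENNReal.ofReal ((∫ t, (F t ω - ∫ x, F t x ∂P) ∂μ) ^ 2) ∂P ≤ ENNReal.ofReal b := by
  set G : T → Ω → ℝ := fun t ω => F t ω - ∫ x, F t x ∂P with hG
  have hGm : Measurable (Function.uncurry G) := by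
    have h1 : Measurable fun t => ∫ x, F t x ∂P :=
      (hF.stronglyMeasurable.integral_prod_right (ν := P)).measurable
    exact hF.sub (h1.comp measurable_fst)
  have hGL : ∀ t, MemLp (G t) 2 P := fun t => (hL t).sub (memLp_const _)
  have hGM : ∀ t, ∫ ω, G t ω ^ 2 ∂P ≤ M := fun t => by
    rw [← variance_eq_integral (hL t).aemeasurable]
    exact hM t
  set φ : Ω × (T × T) → ℝ := fun z => G z.2.1 z.1 * G z.2.2 z.1 with hφ
  have hφm : Measurable φ :=
    (hGm.comp (measurable_snd.fst.prodMk measurable_fst)).mul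
      (hGm.comp (measurable_snd.snd.prodMk measurable_fst))
  have hmul : ∀ s t, Integrable (fun ω => G s ω * G t ω) P := fun s t =>
    (hGL s).integrable_mul (hGL t)
  have hφi : Integrable φ (P.prod (μ.prod μ)) := by
    rw [integrable_prod_iff' hφm.aestronglyMeasurable]
    refine ⟨ae_of_all _ fun p => hmul p.1 p.2, ?_⟩
    refine Integrable.of_bound (C := M)
      hφm.norm.stronglyMeasurable.integral_prod_left'.aestronglyMeasurable (ae_of_all _ fun p => ?_)
    rw [Real.norm_of_nonneg (integral_nonneg fun ω => norm_nonneg _)]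
    have h1 : ∫ ω, ‖G p.1 ω * G p.2 ω‖ ∂P ≤ ∫ ω, (G p.1 ω ^ 2 + G p.2 ω ^ 2) / 2 ∂P := by
      refine integral_mono (hmul _ _).norm
        (((hGL _).integrable_sq.add (hGL _).integrable_sq).div_const 2) fun ω => ?_
      simp only [Real.norm_eq_abs, abs_mul]
      rw [← sq_abs (G p.1 ω), ← sq_abs (G p.2 ω)]
      nlinarith [sq_nonneg (|G p.1 ω| - |G p.2 ω|)]
    rw [integral_div, integral_add (hGL _).integrable_sq (hGL _).integrable_sq] at h1
    linarith [hGM p.1, hGM p.2]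
  have hsq : ∀ ω, (∫ t, G t ω ∂μ) ^ 2 = ∫ p, φ (ω, p) ∂(μ.prod μ) := fun ω => by
    rw [sq, ← integral_prod_mul]
  have hi : Integrable (fun ω => (∫ t, G t ω ∂μ) ^ 2) P := by
    simp_rw [hsq]
    exact hφi.integral_prod_left
  rw [← ofReal_integral_eq_lintegral_ofReal hi (ae_of_all _ fun ω => sq_nonneg _)]
  refine ENNReal.ofReal_le_ofReal (le_trans ?_ hb)
  simp_rw [hsq]
  rw [integral_integral_swap hφi]
  refine (le_abs_self _).trans ?_
  exact abs_integral_le_integral_abs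

end SecondMoment

/-- The pairs of times for which no decorrelation is available, being `η`-close to the origin or to
one another, form a set of measure `O(η)`. -/
lemma prod_restrict_near_boundary_le {J : Set ℝ} (hJ1 : J ⊆ Set.Icc 0 1)
    {η : ℝ} (hη : 0 < η) :
    ((volume.restrict J).prod (volume.restrict J)).real
      {p : ℝ × ℝ | p.1 < η ∨ p.2 < η ∨ |p.2 - p.1| < η} ≤ 4 * η := by
  set μ := (volume.restrict J : Measure ℝ) with hμ
  have hfin : volume J ≤ 1 := (measure_mono hJ1).trans (by simp)
  have hμ1 : μ Set.univ ≤ 1 := by rw [hμ, Measure.restrict_apply_univ]; exact hfin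
  have : IsFiniteMeasure μ := ⟨hμ1.trans_lt ENNReal.one_lt_top⟩
  have h1 : μ (Set.Iio η) ≤ ENNReal.ofReal η := by
    rw [hμ, Measure.restrict_apply measurableSet_Iio]
    calc volume (Set.Iio η ∩ J) ≤ volume (Set.Ico 0 η) :=
          measure_mono fun x hx => ⟨(hJ1 hx.2).1, hx.1⟩
      _ = _ := by simp
  have hA : (μ.prod μ) {p : ℝ × ℝ | p.1 < η} ≤ ENNReal.ofReal η := by
    have : {p : ℝ × ℝ | p.1 < η} = Set.Iio η ×ˢ Set.univ := by ext; simp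
    rw [this, Measure.prod_prod]
    exact (mul_le_mul' h1 hμ1).trans_eq (mul_one _)
  have hB : (μ.prod μ) {p : ℝ × ℝ | p.2 < η} ≤ ENNReal.ofReal η := by
    have : {p : ℝ × ℝ | p.2 < η} = Set.univ ×ˢ Set.Iio η := by ext; simp
    rw [this, Measure.prod_prod]
    exact (mul_le_mul' hμ1 h1).trans_eq (one_mul _)
  have hC : (μ.prod μ) {p : ℝ × ℝ | |p.2 - p.1| < η} ≤ ENNReal.ofReal (2 * η) := by
    rw [Measure.prod_apply (measurableSet_lt (by fun_prop) (by fun_prop))]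
    calc ∫⁻ x, μ (Prod.mk x ⁻¹' {p : ℝ × ℝ | |p.2 - p.1| < η}) ∂μ
        ≤ ∫⁻ _, ENNReal.ofReal (2 * η) ∂μ := by
          refine lintegral_mono fun x => ?_
          refine (Measure.restrict_apply_le _ _).trans ?_
          have : Prod.mk x ⁻¹' {p : ℝ × ℝ | |p.2 - p.1| < η} = Metric.ball x η := by
            ext y; simp [Real.dist_eq]
          rw [this, Real.volume_ball]
      _ = ENNReal.ofReal (2 * η) * μ Set.univ := lintegral_const _
      _ ≤ _ := (mul_le_mul' le_rfl hμ1).trans_eq (mul_one _)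
  refine ENNReal.toReal_le_of_le_ofReal (by positivity) ?_
  calc (μ.prod μ) {p : ℝ × ℝ | p.1 < η ∨ p.2 < η ∨ |p.2 - p.1| < η}
      ≤ (μ.prod μ) {p : ℝ × ℝ | p.1 < η} + ((μ.prod μ) {p : ℝ × ℝ | p.2 < η} +
          (μ.prod μ) {p : ℝ × ℝ | |p.2 - p.1| < η}) :=
        (measure_union_le _ _).trans (add_le_add le_rfl (measure_union_le _ _))
    _ ≤ ENNReal.ofReal η + (ENNReal.ofReal η + ENNReal.ofReal (2 * η)) := by gcongr
    _ = _ := by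
        rw [← ENNReal.ofReal_add (by positivity) (by positivity),
          ← ENNReal.ofReal_add (by positivity) (by positivity)]
        ring_nf

lemma tendsto_integral_gaussianReal {f : ℝ → ℝ} {C : ℝ} {m : ℕ} (hf : PolyLip f C m)
    {ι : Type*} {l : Filter ι} [l.IsCountablyGenerated] {v : ι → ℝ≥0} {v₀ : ℝ≥0}
    (hv2 : ∀ i, v i ≤ 2) (hv : Tendsto v l (𝓝 v₀)) :
    Tendsto (fun i => ∫ x, f x ∂(gaussianReal 0 (v i))) l
      (𝓝 (∫ x, f x ∂(gaussianReal 0 v₀))) := by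
  have hfc := hf.continuous
  have h : ∀ v : ℝ≥0, ∫ x, f x ∂(gaussianReal 0 v) = ∫ x, f (√v * x) ∂(gaussianReal 0 1) := by
    intro v
    rw [← map_sqrt_mul_gaussianReal, integral_map (by fun_prop) hfc.aestronglyMeasurable]
  simp_rw [h]
  refine tendsto_integral_filter_of_dominated_convergence
    (fun x => (|f 0| + C) * (2 ^ (m + 1) * (1 + |x|) ^ (m + 1))) ?_ ?_ ?_ ?_
  · exact Eventually.of_forall fun i =>
      (hfc.comp (continuous_const.mul continuous_id)).aestronglyMeasurable
  · refine Eventually.of_forall fun i => ae_of_all _ fun x => ?_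
    refine (hf.growth _).trans ?_
    have hs : √(v i : ℝ) ≤ 2 := by
      rw [Real.sqrt_le_left (by norm_num)]
      have : (v i : ℝ) ≤ 2 := by exact_mod_cast hv2 i
      linarith
    have hx := abs_nonneg x
    have hC := hf.nonneg
    rw [← mul_pow, abs_mul, abs_of_nonneg (Real.sqrt_nonneg _)]
    gcongr
    nlinarith
  · exact ((integrable_one_add_abs_pow 1 _).const_mul _).const_mul _
  · refine ae_of_all _ fun x => ?_
    have h1 : Continuous fun v : ℝ≥0 => f (√v * x) := by fun_prop
    exact (h1.tendsto v₀).comp hv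

namespace IsBifBm

lemma continuous_Z {Ω : Type*} {H K : ℝ} {B : ℝ≥0 → Ω → ℝ} {ω : Ω}
    (hc : Continuous fun t => B t ω) (ε : ℝ) :
    Continuous fun t => bifBmZ H K B ε t ω := by
  have h1 : Continuous fun t : ℝ => B (t + ε).toNNReal ω := hc.comp (by fun_prop)
  have h2 : Continuous fun t : ℝ => B t.toNNReal ω := hc.comp (by fun_prop)
  exact (h1.sub h2).div_const _

variable {Ω : Type*} [MeasurableSpace Ω] {P : Measure Ω} [IsProbabilityMeasure P]
  {H K : ℝ} {B : ℝ≥0 → Ω → ℝ} {f : ℝ → ℝ} {C : ℝ} {m : ℕ} {J : Set ℝ}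

lemma measurable_uncurry_Z (hm : ∀ t, Measurable (B t)) (hc : ∀ ω, Continuous fun t => B t ω)
    (ε : ℝ) : Measurable (Function.uncurry fun t ω => bifBmZ H K B ε t ω) := by
  have h : Measurable (Function.uncurry B) := measurable_uncurry_of_continuous_of_measurable hc hm
  have h1 : Measurable fun p : ℝ × Ω => B (p.1 + ε).toNNReal p.2 :=
    h.comp ((measurable_fst.add_const ε).real_toNNReal.prodMk measurable_snd)
  have h2 : Measurable fun p : ℝ × Ω => B p.1.toNNReal p.2 :=
    h.comp (measurable_fst.real_toNNReal.prodMk measurable_snd)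
  exact (h1.sub h2).div_const _

/-- The variance of `∫_J f (Z_ε(t)) dt` decays like a power of `ε`. -/
lemma exists_lintegral_sq_le (hB : IsBifBm H K B P) (hH : H ∈ Set.Ioo (0 : ℝ) 1)
    (hK : K ∈ Set.Ioc (0 : ℝ) 1) (hm : ∀ t, Measurable (B t))
    (hc : ∀ ω, Continuous fun t => B t ω) (hf : PolyLip f C m) (hJ : MeasurableSet J)
    (hJ1 : J ⊆ Set.Icc 0 1) :
    ∃ D, 0 ≤ D ∧ ∀ ε ∈ Set.Ioc (0 : ℝ) 1,
      ∫⁻ ω, ENNReal.ofReal ((∫ t in J, (f (bifBmZ H K B ε t ω) -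
        ∫ x, f (bifBmZ H K B ε t x) ∂P)) ^ 2) ∂P ≤
        ENNReal.ofReal (D * ε ^ ((2 - 2 * H * K) / 7)) := by
  obtain ⟨D, hD0, hD1, hD2⟩ := hB.exists_cov_comp_Z_le hH hK hf
  refine ⟨9 * D, by positivity, fun ε hε => ?_⟩
  have hε0 := hε.1
  have hfin : volume J ≤ 1 := (measure_mono hJ1).trans (by simp)
  set μ := (volume.restrict J : Measure ℝ) with hμ
  have hμ1 : μ Set.univ ≤ 1 := by rw [hμ, Measure.restrict_apply_univ]; exact hfin
  have : IsFiniteMeasure μ := ⟨hμ1.trans_lt ENNReal.one_lt_top⟩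
  set θ := 2 - 2 * H * K with hθ
  have hHK : H * K < 1 := by nlinarith [hH.1, hH.2, hK.1, hK.2]
  have hHK0 : 0 < H * K := mul_pos hH.1 hK.1
  have hθ0 : 0 < θ := by rw [hθ]; linarith
  have hθ2 : θ < 2 := by rw [hθ]; linarith
  -- The exceptional pairs contribute `O(η)`, the others `O(η ^ (-6) ε ^ θ)`; the exponent `θ / 7`
  -- balances the two. The factor `2` ensures that `2 ε ≤ η`.
  set η := 2 * ε ^ (θ / 7) with hη
  have hη0 : 0 < η := by positivity
  have hεη : 2 * ε ≤ η := by
    have := Real.rpow_le_rpow_of_exponent_ge hε0 hε.2 (show θ / 7 ≤ 1 by linarith)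
    rw [Real.rpow_one] at this
    linarith
  have hηε : η⁻¹ ^ 6 * ε ^ θ ≤ ε ^ (θ / 7) := by
    have h1 : ε ^ θ = (ε ^ (θ / 7)) ^ 7 := by
      rw [← Real.rpow_natCast, ← Real.rpow_mul hε0.le]
      congr 1
      push_cast
      ring
    have h2 : 0 < ε ^ (θ / 7) := by positivity
    have h3 : η⁻¹ ^ 6 * ε ^ θ = (1 / 64) * ε ^ (θ / 7) := by
      rw [h1, hη]
      field_simp
      norm_num
    linarith
  refine lintegral_sq_integral_sub_le (M := D) (F := fun t ω => f (bifBmZ H K B ε t ω)) ?_ ?_ ?_ ?_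
  · exact hf.continuous.measurable.comp (measurable_uncurry_Z hm hc ε)
  · exact fun t => hf.memLp_two_comp (hB.hasGaussianLaw_Z ε t) (hB.integral_Z ε t)
  · intro t
    have h := hD1 ε t t hε0
    rw [covariance_self
      (hf.memLp_two_comp (hB.hasGaussianLaw_Z ε t) (hB.integral_Z ε t)).aemeasurable] at h
    exact (le_abs_self _).trans h
  · set S := {p : ℝ × ℝ | p.1 < η ∨ p.2 < η ∨ |p.2 - p.1| < η} with hS
    have hSm : MeasurableSet S :=
      (measurableSet_lt measurable_fst measurable_const).union
        ((measurableSet_lt measurable_snd measurable_const).union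
          (measurableSet_lt (f := fun p : ℝ × ℝ => |p.2 - p.1|) (by fun_prop) measurable_const))
    have hSμ : (μ.prod μ).real S ≤ 4 * η := prod_restrict_near_boundary_le hJ1 hη0
    have hae : ∀ᵐ p ∂(μ.prod μ), p.1 ∈ J ∧ p.2 ∈ J := by
      have : μ.prod μ = (volume.prod volume).restrict (J ×ˢ J) := Measure.prod_restrict J J
      rw [this]
      exact ae_restrict_mem (hJ.prod hJ)
    have huniv : (μ.prod μ).real Set.univ ≤ 1 := by
      refine ENNReal.toReal_le_of_le_ofReal zero_le_one ?_
      rw [← Set.univ_prod_univ, Measure.prod_prod, ENNReal.ofReal_one]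
      exact mul_le_one' hμ1 hμ1
    calc ∫ p, |cov[fun ω => f (bifBmZ H K B ε p.1 ω), fun ω => f (bifBmZ H K B ε p.2 ω); P]|
          ∂(μ.prod μ)
        ≤ ∫ p, (D * ε ^ (θ / 7) + S.indicator (fun _ => D) p) ∂(μ.prod μ) := by
          refine integral_mono_of_nonneg (ae_of_all _ fun p => abs_nonneg _)
            ((integrable_const _).add ((integrable_const D).indicator hSm)) ?_
          filter_upwards [hae] with p hp
          by_cases hpS : p ∈ S
          · rw [Set.indicator_of_mem hpS]
            have := hD1 ε p.1 p.2 hε0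
            have h2 : 0 ≤ D * ε ^ (θ / 7) := by positivity
            linarith
          · rw [Set.indicator_of_notMem hpS, add_zero]
            simp only [hS, Set.mem_ofPred_eq, not_or, not_lt] at hpS
            refine (hD2 ε η p.1 p.2 hε hη0 hεη ⟨hpS.1, (hJ1 hp.1).2⟩ ⟨hpS.2.1, (hJ1 hp.2).2⟩
              hpS.2.2).trans ?_
            gcongr
      _ = (μ.prod μ).real Set.univ * (D * ε ^ (θ / 7)) + (μ.prod μ).real S * D := by
          rw [integral_add (integrable_const _) ((integrable_const D).indicator hSm),
            integral_const, integral_indicator_const _ hSm]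
          simp
      _ ≤ 1 * (D * ε ^ (θ / 7)) + 4 * η * D := by gcongr
      _ = _ := by rw [hη]; ring

lemma tendsto_var_Z (hB : IsBifBm H K B P) (hH : H ∈ Set.Ioo (0 : ℝ) 1)
    (hK : K ∈ Set.Ioc (0 : ℝ) 1) {t : ℝ} (ht : t ∈ Set.Ioc (0 : ℝ) 1) :
    Tendsto (fun ε => Var[bifBmZ H K B ε t; P]) (𝓝[>] 0) (𝓝 (2 ^ (1 - K))) := by
  have hθ0 : 0 < 2 - 2 * H * K := by nlinarith [hH.1, hH.2, hK.1, hK.2]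
  rw [tendsto_iff_dist_tendsto_zero]
  have h1 : Tendsto (fun ε : ℝ => 16 * t⁻¹ ^ 6 * ε ^ (2 - 2 * H * K)) (𝓝[>] 0) (𝓝 0) := by
    simpa only [mul_zero] using (tendsto_rpow_nhdsGT_zero hθ0).const_mul (16 * t⁻¹ ^ 6)
  refine squeeze_zero' (Eventually.of_forall fun _ => dist_nonneg) ?_ h1
  filter_upwards [Ioc_mem_nhdsGT zero_lt_one] with ε hε
  rw [Real.dist_eq]
  exact hB.var_Z_sub hH hK hε ht.1 ⟨le_rfl, ht.2⟩

lemma abs_integral_comp_Z_le (hB : IsBifBm H K B P) (hH : H ∈ Set.Ioo (0 : ℝ) 1)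
    (hK : K ∈ Set.Ioc (0 : ℝ) 1) (hf : PolyLip f C m) {ε : ℝ} (hε : 0 < ε) (t : ℝ) :
    |∫ x, f (bifBmZ H K B ε t x) ∂P| ≤ (|f 0| + C) * gaussMoment (m + 1) := by
  have hG := hB.hasGaussianLaw_Z ε t
  have h0 := hB.integral_Z ε t
  calc |∫ x, f (bifBmZ H K B ε t x) ∂P|
      ≤ ∫ x, (|f 0| + C) * (1 + |bifBmZ H K B ε t x|) ^ (m + 1) ∂P :=
        abs_integral_le_of_abs_le ((hG.integrable_pow h0 _).const_mul _) fun x => hf.growth _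
    _ ≤ _ := by
        have hC := hf.nonneg
        rw [integral_const_mul]
        gcongr
        exact hG.integral_pow_le h0 (hB.var_Z_le hH hK hε t) _

/-- Convergence of the expectation of `∫_J f (Z_ε(t)) dt`. -/
lemma tendsto_integral_mean (hB : IsBifBm H K B P) (hH : H ∈ Set.Ioo (0 : ℝ) 1)
    (hK : K ∈ Set.Ioc (0 : ℝ) 1) (hm : ∀ t, Measurable (B t))
    (hc : ∀ ω, Continuous fun t => B t ω) (hf : PolyLip f C m) (hJ : MeasurableSet J)
    (hJ1 : J ⊆ Set.Icc 0 1) :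
    Tendsto (fun ε => ∫ t in J, ∫ x, f (bifBmZ H K B ε t x) ∂P) (𝓝[>] 0)
      (𝓝 (volume.real J * ∫ x, f x ∂(gaussianReal 0 ((2 : ℝ≥0) ^ (1 - K))))) := by
  have hfin : volume J ≤ 1 := (measure_mono hJ1).trans (by simp)
  have : IsFiniteMeasure (volume.restrict J : Measure ℝ) :=
    ⟨by rw [Measure.restrict_apply_univ]; exact hfin.trans_lt ENNReal.one_lt_top⟩
  have hlim : volume.real J * ∫ x, f x ∂(gaussianReal 0 ((2 : ℝ≥0) ^ (1 - K))) =
      ∫ _ in J, ∫ x, f x ∂(gaussianReal 0 ((2 : ℝ≥0) ^ (1 - K))) := by simp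
  rw [hlim]
  have hZm : ∀ ε, Measurable (Function.uncurry fun t ω => f (bifBmZ H K B ε t ω)) := fun ε =>
    hf.continuous.measurable.comp (measurable_uncurry_Z hm hc ε)
  refine tendsto_integral_filter_of_dominated_convergence
    (fun _ => (|f 0| + C) * gaussMoment (m + 1)) ?_ ?_ (integrable_const _) ?_
  · exact Eventually.of_forall fun ε =>
      ((hZm ε).stronglyMeasurable.integral_prod_right (ν := P)).aestronglyMeasurable
  · filter_upwards [self_mem_nhdsWithin] with ε hε
    refine ae_of_all _ fun t => ?_
    exact hB.abs_integral_comp_Z_le hH hK hf hε t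
  · have h0 : ∀ᵐ t ∂(volume.restrict J), t ≠ 0 :=
      ae_restrict_of_ae (Measure.ae_ne volume 0)
    filter_upwards [h0, ae_restrict_mem hJ] with t ht0 htJ
    have ht : t ∈ Set.Ioc (0 : ℝ) 1 :=
      ⟨lt_of_le_of_ne (hJ1 htJ).1 ht0.symm, (hJ1 htJ).2⟩
    have hv := (tendsto_real_toNNReal (hB.tendsto_var_Z hH hK ht))
    have hv2 : ((2 : ℝ) ^ (1 - K)).toNNReal = (2 : ℝ≥0) ^ (1 - K) := by
      rw [Real.toNNReal_rpow_of_nonneg zero_le_two]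
      simp
    rw [hv2] at hv
    have h22 : (2 : ℝ≥0) ^ (1 - K) ≤ 2 := by
      calc (2 : ℝ≥0) ^ (1 - K) ≤ 2 ^ (1 : ℝ) :=
            NNReal.rpow_le_rpow_of_exponent_le one_le_two (by linarith [hK.1])
        _ = 2 := NNReal.rpow_one 2
    -- The variance is at most `2` for `ε > 0` only, hence the truncation.
    have hT := tendsto_integral_gaussianReal hf (l := 𝓝[>] (0 : ℝ))
      (v := fun ε => min (Var[bifBmZ H K B ε t; P]).toNNReal 2) (fun i => min_le_right _ _)
      (v₀ := (2 : ℝ≥0) ^ (1 - K)) (by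
        have := hv.min (tendsto_const_nhds (x := (2 : ℝ≥0)))
        rwa [min_eq_left h22] at this)
    refine hT.congr' ?_
    filter_upwards [self_mem_nhdsWithin] with ε hε
    have hle : (Var[bifBmZ H K B ε t; P]).toNNReal ≤ 2 := by
      rw [Real.toNNReal_le_iff_le_coe]
      exact_mod_cast hB.var_Z_le hH hK hε t
    have hlaw := (hB.hasGaussianLaw_Z ε t).hasLaw_of_centered (hB.integral_Z ε t)
    rw [min_eq_left hle, ← hlaw.map_eq, integral_map hlaw.aemeasurable
      hf.continuous.aestronglyMeasurable]

end IsBifBm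

/-! ### Convergence along a polynomial grid -/

namespace IsBifBm

variable {Ω : Type*} [MeasurableSpace Ω] {P : Measure Ω} [IsProbabilityMeasure P]
  {H K : ℝ} {B : ℝ≥0 → Ω → ℝ} {f : ℝ → ℝ} {C : ℝ} {m : ℕ} {J : Set ℝ}

/-- Almost sure convergence along `ε = n ^ (-q)`: for large `q` the variances are summable, so the
sum over `n` of the squared fluctuations is almost surely finite. At `n = 0` the value of `ε` is
the junk `0⁻¹ = 0`, which does not affect the limit. -/
lemma ae_tendsto_integral_grid (hB : IsBifBm H K B P) (hH : H ∈ Set.Ioo (0 : ℝ) 1)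
    (hK : K ∈ Set.Ioc (0 : ℝ) 1) (hm : ∀ t, Measurable (B t))
    (hc : ∀ ω, Continuous fun t => B t ω) (hf : PolyLip f C m) (hJ : MeasurableSet J)
    (hJ1 : J ⊆ Set.Icc 0 1) {q : ℕ} (hq : 2 ≤ q * ((2 - 2 * H * K) / 7)) :
    ∀ᵐ ω ∂P, Tendsto (fun n : ℕ => ∫ t in J, f (bifBmZ H K B (((n : ℝ) ^ q)⁻¹) t ω)) atTop
      (𝓝 (volume.real J * ∫ x, f x ∂(gaussianReal 0 ((2 : ℝ≥0) ^ (1 - K))))) := by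
  obtain ⟨D, hD0, hD⟩ := hB.exists_lintegral_sq_le hH hK hm hc hf hJ hJ1
  have hq0 : q ≠ 0 := by
    rintro rfl
    simp at hq
    linarith
  have hfin : volume J ≤ 1 := (measure_mono hJ1).trans (by simp)
  have : IsFiniteMeasure (volume.restrict J : Measure ℝ) :=
    ⟨by rw [Measure.restrict_apply_univ]; exact hfin.trans_lt ENNReal.one_lt_top⟩
  set e : ℕ → ℝ := fun n => (((n + 1 : ℕ) : ℝ) ^ q)⁻¹ with he
  have he1 : ∀ n, e n ∈ Set.Ioc (0 : ℝ) 1 := fun n => by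
    have h1 : (1 : ℝ) ≤ ((n + 1 : ℕ) : ℝ) ^ q := one_le_pow₀ (by simp)
    exact ⟨by positivity, inv_le_one_of_one_le₀ h1⟩
  have hZm : ∀ ε, Measurable (Function.uncurry fun t ω => f (bifBmZ H K B ε t ω)) := fun ε =>
    hf.continuous.measurable.comp (measurable_uncurry_Z hm hc ε)
  set I : ℕ → Ω → ℝ := fun n ω => ∫ t in J, (f (bifBmZ H K B (e n) t ω) -
        ∫ x, f (bifBmZ H K B (e n) t x) ∂P) with hI
  have hIm : ∀ n, Measurable (I n) := fun n => by
    have h1 : Measurable fun t => ∫ x, f (bifBmZ H K B (e n) t x) ∂P :=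
      ((hZm (e n)).stronglyMeasurable.integral_prod_right (ν := P)).measurable
    exact (((hZm (e n)).sub (h1.comp measurable_fst)).stronglyMeasurable.integral_prod_left
      (μ := volume.restrict J)).measurable
  have hsum : ∫⁻ ω, ∑' n, ENNReal.ofReal (I n ω ^ 2) ∂P ≠ ⊤ := by
    rw [lintegral_tsum fun n => ((hIm n).pow_const 2).ennreal_ofReal.aemeasurable]
    have hs : Summable fun n : ℕ => D * (((n + 1 : ℕ) : ℝ) ^ 2)⁻¹ :=
      ((summable_nat_add_iff 1).2 (Real.summable_nat_pow_inv.2 one_lt_two)).mul_left D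
    refine ne_top_of_le_ne_top hs.tsum_ofReal_ne_top (ENNReal.tsum_le_tsum fun n => ?_)
    refine (hD (e n) (he1 n)).trans (ENNReal.ofReal_le_ofReal ?_)
    gcongr
    have hn : (1 : ℝ) ≤ ((n + 1 : ℕ) : ℝ) := by simp
    have hn0 : (0 : ℝ) ≤ ((n + 1 : ℕ) : ℝ) := by positivity
    rw [he, Real.inv_rpow (by positivity)]
    apply inv_anti₀ (by positivity)
    rw [← Real.rpow_natCast _ q, ← Real.rpow_mul hn0, ← Real.rpow_natCast _ 2]
    exact Real.rpow_le_rpow_of_exponent_le hn (by exact_mod_cast hq)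
  have hae := ae_lt_top (Measurable.tsum fun n => ((hIm n).pow_const 2).ennreal_ofReal) hsum
  have hmean : Tendsto (fun n => ∫ t in J, ∫ x, f (bifBmZ H K B (e n) t x) ∂P) atTop
      (𝓝 (volume.real J * ∫ x, f x ∂(gaussianReal 0 ((2 : ℝ≥0) ^ (1 - K))))) := by
    refine (hB.tendsto_integral_mean hH hK hm hc hf hJ hJ1).comp ?_
    rw [tendsto_nhdsWithin_iff]
    refine ⟨?_, Eventually.of_forall fun n => (he1 n).1⟩
    have h1 : Tendsto (fun n : ℕ => ((n : ℝ) ^ q)⁻¹) atTop (𝓝 0) :=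
      tendsto_inv_atTop_zero.comp ((tendsto_pow_atTop hq0).comp tendsto_natCast_atTop_atTop)
    exact h1.comp (tendsto_add_atTop_nat 1)
  filter_upwards [hae] with ω hω
  have h1 : Tendsto (fun n => ENNReal.ofReal (I n ω ^ 2)) atTop (𝓝 0) :=
    ENNReal.tendsto_atTop_zero_of_tsum_ne_top hω.ne
  have h2 : Tendsto (fun n => I n ω ^ 2) atTop (𝓝 0) := by
    have h3 := (ENNReal.tendsto_toReal ENNReal.zero_ne_top).comp h1
    simpa [Function.comp_def, ENNReal.toReal_ofReal (sq_nonneg _)] using h3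
  have h3 : Tendsto (fun n => I n ω) atTop (𝓝 0) := by
    rw [tendsto_zero_iff_abs_tendsto_zero]
    have h4 := (Real.continuous_sqrt.tendsto 0).comp h2
    simpa [Function.comp_def, Real.sqrt_sq_eq_abs] using h4
  rw [← tendsto_add_atTop_iff_nat 1]
  have h5 := h3.add hmean
  rw [zero_add] at h5
  refine h5.congr fun n => ?_
  have hi1 : Integrable (fun t => f (bifBmZ H K B (e n) t ω)) (volume.restrict J) :=
    ((hf.continuous.comp (continuous_Z (hc ω) (e n))).continuousOn.integrableOn_compact
      isCompact_Icc).mono_set hJ1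
  have hi2 : Integrable (fun t => ∫ x, f (bifBmZ H K B (e n) t x) ∂P) (volume.restrict J) := by
    refine Integrable.of_bound (C := (|f 0| + C) * gaussMoment (m + 1))
      ((hZm (e n)).stronglyMeasurable.integral_prod_right (ν := P)).aestronglyMeasurable
      (ae_of_all _ fun t => ?_)
    exact hB.abs_integral_comp_Z_le hH hK hf (he1 n).1 t
  simp only [hI]
  rw [integral_sub hi1 hi2, sub_add_cancel]

end IsBifBm

/-! ### Hölder continuity of the paths -/

/-- The largest multiple of `2 ^ (-n)` not exceeding `t` (for `t ≥ 0`). -/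
noncomputable def dyadicFloor (n : ℕ) (t : ℝ) : ℝ := (⌊(2 : ℝ) ^ n * t⌋₊ : ℝ) / 2 ^ n

lemma tendsto_dyadicFloor {t : ℝ} (ht : 0 ≤ t) :
    Tendsto (fun n => dyadicFloor n t) atTop (𝓝 t) := by
  have h : Tendsto (fun n : ℕ => ((2 : ℝ) ^ n)⁻¹) atTop (𝓝 0) :=
    tendsto_inv_atTop_zero.comp (tendsto_pow_atTop_atTop_of_one_lt one_lt_two)
  rw [tendsto_iff_dist_tendsto_zero]
  refine squeeze_zero (fun _ => dist_nonneg) (fun n => ?_) h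
  have h2 : (0 : ℝ) < 2 ^ n := by positivity
  have h3 := Nat.floor_le (show 0 ≤ (2 : ℝ) ^ n * t by positivity)
  have h4 := Nat.lt_floor_add_one ((2 : ℝ) ^ n * t)
  rw [Real.dist_eq, dyadicFloor, abs_le]
  have h5 : ((⌊(2 : ℝ) ^ n * t⌋₊ : ℝ) / 2 ^ n - t) =
      ((⌊(2 : ℝ) ^ n * t⌋₊ : ℝ) - 2 ^ n * t) / 2 ^ n := by
    field_simp
  rw [h5]
  constructor
  · rw [neg_eq_neg_one_mul, ← div_eq_mul_inv]
    gcongr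
    linarith
  · rw [← one_div]
    gcongr
    linarith

/-- Dyadic chaining: a continuous function whose increments over the dyadic intervals of
`[0, 2]` of length `2 ^ (-n)` are `O(2 ^ (-n γ))` is `γ`-Hölder on `[0, 2]`. -/
lemma exists_holder_of_dyadic {b : ℝ → ℝ} (hb : Continuous b) {γ A : ℝ} (hγ : 0 < γ) (hA : 0 ≤ A)
    (h : ∀ n k : ℕ, k < 2 ^ (n + 1) →
      |b ((k : ℝ) / 2 ^ n + (1 / 2) ^ n) - b ((k : ℝ) / 2 ^ n)| ≤ A * ((1 / 2 : ℝ) ^ n) ^ γ) :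
    ∃ L, 0 ≤ L ∧ ∀ s ∈ Set.Icc (0 : ℝ) 2, ∀ t ∈ Set.Icc (0 : ℝ) 2, |s - t| ≤ 1 →
      |b s - b t| ≤ L * |s - t| ^ γ := by
  set r : ℝ := (1 / 2) ^ γ with hr
  have hr0 : 0 < r := by positivity
  have hr1 : r < 1 := Real.rpow_lt_one (by norm_num) (by norm_num) hγ
  have hrn : ∀ n : ℕ, ((1 / 2 : ℝ) ^ n) ^ γ = r ^ n := fun n => by
    rw [hr, ← Real.rpow_natCast, ← Real.rpow_natCast, ← Real.rpow_mul (by norm_num),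
      ← Real.rpow_mul (by norm_num), mul_comm]
  simp_rw [hrn] at h
  -- Successive dyadic approximations of a point are equal or adjacent at the finer level.
  have hstep : ∀ t ∈ Set.Icc (0 : ℝ) 2, ∀ n : ℕ,
      dist (b (dyadicFloor n t)) (b (dyadicFloor (n + 1) t)) ≤ A * r ^ n := by
    intro t ht n
    set k := ⌊(2 : ℝ) ^ n * t⌋₊ with hk
    have hpos : 0 ≤ (2 : ℝ) ^ n * t := mul_nonneg (by positivity) ht.1
    have h3 := Nat.floor_le hpos
    have h4 := Nat.lt_floor_add_one ((2 : ℝ) ^ n * t)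
    rw [← hk] at h3 h4
    have hk0 : dyadicFloor n t = ((2 * k : ℕ) : ℝ) / 2 ^ (n + 1) := by
      rw [dyadicFloor, ← hk]
      push_cast
      field_simp
      ring
    have hle : 2 * k ≤ ⌊(2 : ℝ) ^ (n + 1) * t⌋₊ := by
      apply Nat.le_floor
      push_cast
      rw [pow_succ]
      linarith
    have hlt : ⌊(2 : ℝ) ^ (n + 1) * t⌋₊ < 2 * k + 2 := by
      rw [Nat.floor_lt (mul_nonneg (by positivity) ht.1)]
      push_cast
      rw [pow_succ]
      linarith
    have hcases : ⌊(2 : ℝ) ^ (n + 1) * t⌋₊ = 2 * k ∨ ⌊(2 : ℝ) ^ (n + 1) * t⌋₊ = 2 * k + 1 := by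
      omega
    rcases hcases with hc | hc
    · have : dyadicFloor (n + 1) t = dyadicFloor n t := by rw [hk0, dyadicFloor, hc]
      rw [this, dist_self]
      positivity
    · have h5 : dyadicFloor (n + 1) t =
          ((2 * k : ℕ) : ℝ) / 2 ^ (n + 1) + (1 / 2) ^ (n + 1) := by
        rw [dyadicFloor, hc, one_div, inv_pow]
        push_cast
        field_simp
      have h6 : 2 * k < 2 ^ (n + 1 + 1) := by
        have h7 := Nat.floor_le (show 0 ≤ (2 : ℝ) ^ (n + 1) * t from
          mul_nonneg (by positivity) ht.1)
        rw [hc] at h7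
        have h8 : (2 : ℝ) ^ (n + 1) * t ≤ 2 ^ (n + 1 + 1) := by
          rw [pow_succ _ (n + 1)]
          have := ht.2
          gcongr
        have h9 : ((2 * k + 1 : ℕ) : ℝ) ≤ ((2 ^ (n + 1 + 1) : ℕ) : ℝ) := by
          push_cast at h7 ⊢
          linarith
        have h10 : 2 * k + 1 ≤ 2 ^ (n + 1 + 1) := by exact_mod_cast h9
        omega
      have h11 := h (n + 1) (2 * k) h6
      rw [hk0, h5, dist_comm, Real.dist_eq]
      refine h11.trans ?_
      have : r ^ (n + 1) ≤ r ^ n := pow_le_pow_of_le_one hr0.le hr1.le (Nat.le_succ n)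
      gcongr
  have happrox : ∀ t ∈ Set.Icc (0 : ℝ) 2, ∀ n : ℕ,
      |b (dyadicFloor n t) - b t| ≤ A * r ^ n / (1 - r) := fun t ht n =>
    dist_le_of_le_geometric_of_tendsto r A hr1 (hstep t ht)
      ((hb.tendsto t).comp (tendsto_dyadicFloor ht.1)) n
  have h1r : 0 < 1 - r := by linarith
  have hclose : ∀ s ∈ Set.Icc (0 : ℝ) 2, ∀ t ∈ Set.Icc (0 : ℝ) 2, s ≤ t → ∀ n : ℕ,
      t - s ≤ (1 / 2) ^ n → |b (dyadicFloor n t) - b (dyadicFloor n s)| ≤ A * r ^ n := by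
    intro s hs t ht hst n hn
    set k := ⌊(2 : ℝ) ^ n * s⌋₊ with hk
    have h4 := Nat.lt_floor_add_one ((2 : ℝ) ^ n * s)
    rw [← hk] at h4
    have hle : k ≤ ⌊(2 : ℝ) ^ n * t⌋₊ := Nat.floor_le_floor (by gcongr)
    have hlt : ⌊(2 : ℝ) ^ n * t⌋₊ < k + 2 := by
      rw [Nat.floor_lt (mul_nonneg (by positivity) ht.1)]
      have h5 : (2 : ℝ) ^ n * (t - s) ≤ 1 := by
        calc (2 : ℝ) ^ n * (t - s) ≤ 2 ^ n * (1 / 2) ^ n := by gcongr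
          _ = 1 := by rw [← mul_pow]; norm_num
      push_cast
      linarith
    have hcases : ⌊(2 : ℝ) ^ n * t⌋₊ = k ∨ ⌊(2 : ℝ) ^ n * t⌋₊ = k + 1 := by omega
    rcases hcases with hc | hc
    · have : dyadicFloor n t = dyadicFloor n s := by rw [dyadicFloor, dyadicFloor, hc]
      rw [this, sub_self, abs_zero]
      positivity
    · have h5 : dyadicFloor n t = (k : ℝ) / 2 ^ n + (1 / 2) ^ n := by
        rw [dyadicFloor, hc, one_div, inv_pow]
        push_cast
        field_simp
      have h6 : k < 2 ^ (n + 1) := by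
        have h7 := Nat.floor_le (show 0 ≤ (2 : ℝ) ^ n * t from mul_nonneg (by positivity) ht.1)
        rw [hc] at h7
        have h8 : (2 : ℝ) ^ n * t ≤ 2 ^ (n + 1) := by
          rw [pow_succ]
          have := ht.2
          gcongr
        have h9 : ((k + 1 : ℕ) : ℝ) ≤ ((2 ^ (n + 1) : ℕ) : ℝ) := by
          push_cast at h7 ⊢
          linarith
        have h10 : k + 1 ≤ 2 ^ (n + 1) := by exact_mod_cast h9
        omega
      have h12 : dyadicFloor n s = (k : ℝ) / 2 ^ n := rfl
      rw [h5, h12]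
      exact h n k h6
  set L := (A / (1 - r) + A + A / (1 - r)) / r with hL
  have hL0 : 0 ≤ L := by positivity
  refine ⟨L, hL0, fun s hs t ht hst => ?_⟩
  wlog hle : s ≤ t generalizing s t
  · rw [abs_sub_comm, abs_sub_comm s]
    exact this t ht s hs (by rwa [abs_sub_comm]) (le_of_not_ge hle)
  rcases hle.eq_or_lt with rfl | hlt
  · simp [Real.zero_rpow hγ.ne']
  rw [abs_sub_comm, abs_sub_comm s] at *
  rw [abs_of_pos (sub_pos.2 hlt)] at *
  obtain ⟨n, hn1, hn2⟩ := exists_nat_pow_near_of_lt_one (sub_pos.2 hlt) hst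
    (show (0 : ℝ) < 1 / 2 by norm_num) (by norm_num)
  have h1 := happrox t ht n
  have h2 := happrox s hs n
  have h3 := hclose s hs t ht hle n hn2
  have h4 : r ^ (n + 1) ≤ (t - s) ^ γ := by
    rw [← hrn]
    exact Real.rpow_le_rpow (by positivity) hn1.le hγ.le
  have h5 : |b t - b s| ≤ A * r ^ n / (1 - r) + A * r ^ n + A * r ^ n / (1 - r) := by
    have e : b t - b s = -(b (dyadicFloor n t) - b t) +
      (b (dyadicFloor n t) - b (dyadicFloor n s)) + (b (dyadicFloor n s) - b s) := by ring
    rw [e]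
    refine (abs_add_le _ _).trans (add_le_add ((abs_add_le _ _).trans (add_le_add ?_ h3)) h2)
    rwa [abs_neg]
  calc |b t - b s| ≤ A * r ^ n / (1 - r) + A * r ^ n + A * r ^ n / (1 - r) := h5
    _ = L * r ^ (n + 1) := by rw [hL, pow_succ]; field_simp
    _ ≤ _ := by gcongr

namespace IsBifBm

variable {Ω : Type*} [MeasurableSpace Ω] {P : Measure Ω} [IsProbabilityMeasure P]
  {H K : ℝ} {B : ℝ≥0 → Ω → ℝ}

/-- Hölder continuity of the paths on `[0, 2]`, of any order `γ < HK`, by the argument of the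
Kolmogorov continuity criterion. -/
lemma ae_exists_holder (hB : IsBifBm H K B P) (hH : H ∈ Set.Ioo (0 : ℝ) 1)
    (hK : K ∈ Set.Ioc (0 : ℝ) 1) (hm : ∀ t, Measurable (B t))
    (hc : ∀ ω, Continuous fun t => B t ω) {γ : ℝ} (hγ : γ ∈ Set.Ioo 0 (H * K)) :
    ∀ᵐ ω ∂P, ∃ L, 0 ≤ L ∧ ∀ s ∈ Set.Icc (0 : ℝ) 2, ∀ t ∈ Set.Icc (0 : ℝ) 2, |s - t| ≤ 1 →
      |B s.toNNReal ω - B t.toNNReal ω| ≤ L * |s - t| ^ γ := by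
  obtain ⟨hγ0, hγ1⟩ := hγ
  set δ := H * K - γ with hδ
  have hδ0 : 0 < δ := by rw [hδ]; linarith
  -- At level `n`, `2 ^ (n + 1)` increments each contribute `2 ^ (-n p δ) ≤ 4 ^ (-n)`.
  obtain ⟨p, hp⟩ := exists_nat_ge (2 / δ)
  rw [div_le_iff₀ hδ0] at hp
  have hp0 : p ≠ 0 := by
    rintro rfl
    norm_num at hp
  set e : ℕ → ℝ := fun n => (1 / 2) ^ n with he
  have he0 : ∀ n, 0 < e n := fun n => by positivity
  have he1 : ∀ n, e n ≤ 1 := fun n => pow_le_one₀ (by norm_num) (by norm_num)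
  set X : ℕ → ℕ → Ω → ℝ := fun n k ω =>
    (e n ^ δ * (1 + |bifBmZ H K B (e n) ((k : ℝ) / 2 ^ n) ω|)) ^ p with hX
  have hZm : ∀ n k : ℕ, Measurable (bifBmZ H K B (e n) ((k : ℝ) / 2 ^ n)) := fun n k =>
    ((hm _).sub (hm _)).div_const _
  have hXm : ∀ n k, Measurable (X n k) := fun n k =>
    (((continuous_abs.measurable.comp (hZm n k)).const_add 1).const_mul _).pow_const p
  have hX0 : ∀ n k ω, 0 ≤ X n k ω := fun n k ω => by
    have := (he0 n).le
    positivity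
  have hXE : ∀ n k, ∫⁻ ω, ENNReal.ofReal (X n k ω) ∂P ≤
      ENNReal.ofReal ((1 / 4) ^ n * gaussMoment p) := by
    intro n k
    have hG := hB.hasGaussianLaw_Z (e n) ((k : ℝ) / 2 ^ n)
    have h0 := hB.integral_Z (e n) ((k : ℝ) / 2 ^ n)
    have hi : Integrable (X n k) P := by
      simp only [hX, mul_pow]
      exact (hG.integrable_pow h0 p).const_mul _
    rw [← ofReal_integral_eq_lintegral_ofReal hi (ae_of_all _ (hX0 n k))]
    apply ENNReal.ofReal_le_ofReal
    simp only [hX, mul_pow]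
    rw [integral_const_mul]
    have h1 : (e n ^ δ) ^ p ≤ (1 / 4) ^ n := by
      rw [← Real.rpow_natCast, ← Real.rpow_mul (he0 n).le]
      calc e n ^ (δ * p) ≤ e n ^ (2 : ℝ) :=
            Real.rpow_le_rpow_of_exponent_ge (he0 n) (he1 n) (by linarith)
        _ = (1 / 4) ^ n := by
            rw [Real.rpow_two, he, ← pow_mul, mul_comm, pow_mul]
            norm_num
    have h2 := hG.integral_pow_le h0 (hB.var_Z_le hH hK (he0 n) _) p
    have h3 : 0 ≤ ∫ ω, (1 + |bifBmZ H K B (e n) ((k : ℝ) / 2 ^ n) ω|) ^ p ∂P :=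
      integral_nonneg fun ω => by positivity
    exact mul_le_mul h1 h2 h3 (by positivity)
  have hsum : ∫⁻ ω, ∑' n, ∑ k ∈ Finset.range (2 ^ (n + 1)), ENNReal.ofReal (X n k ω) ∂P ≠ ⊤ := by
    rw [lintegral_tsum fun n => (Finset.measurable_sum _ fun k _ =>
      (hXm n k).ennreal_ofReal).aemeasurable]
    have hs : Summable fun n : ℕ => 2 * gaussMoment p * (1 / 2) ^ n :=
      (summable_geometric_of_lt_one (by norm_num) (by norm_num)).mul_left _
    refine ne_top_of_le_ne_top hs.tsum_ofReal_ne_top (ENNReal.tsum_le_tsum fun n => ?_)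
    rw [lintegral_finsetSum _ fun k _ => (hXm n k).ennreal_ofReal]
    calc _ ≤ ∑ _k ∈ Finset.range (2 ^ (n + 1)), ENNReal.ofReal ((1 / 4) ^ n * gaussMoment p) :=
          Finset.sum_le_sum fun k _ => hXE n k
      _ = ENNReal.ofReal (2 * gaussMoment p * (1 / 2) ^ n) := by
          rw [Finset.sum_const, Finset.card_range, nsmul_eq_mul, ← ENNReal.ofReal_natCast,
            ← ENNReal.ofReal_mul (by positivity)]
          congr 1
          push_cast
          have : (1 / 4 : ℝ) ^ n = (1 / 2) ^ n * (1 / 2) ^ n := by rw [← mul_pow]; norm_num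
          have h2 : (2 : ℝ) ^ n * (1 / 2) ^ n = 1 := by rw [← mul_pow]; norm_num
          rw [this, pow_succ]
          linear_combination (2 * gaussMoment p * (1 / 2) ^ n) * h2
  have hae := ae_lt_top (Measurable.tsum fun n => Finset.measurable_sum (Finset.range (2 ^ (n + 1)))
    fun k _ => (hXm n k).ennreal_ofReal) hsum
  filter_upwards [hae] with ω hω
  set S := ∑' n, ∑ k ∈ Finset.range (2 ^ (n + 1)), ENNReal.ofReal (X n k ω) with hS
  have hS0 : 0 ≤ S.toReal := ENNReal.toReal_nonneg
  have hb : Continuous fun t : ℝ => B t.toNNReal ω := (hc ω).comp (by fun_prop)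
  refine exists_holder_of_dyadic hb (A := 1 + S.toReal) hγ0 (by positivity) fun n k hk => ?_
  have h1 : ENNReal.ofReal (X n k ω) ≤ S :=
    (Finset.single_le_sum (f := fun k => ENNReal.ofReal (X n k ω)) (fun _ _ => zero_le)
      (Finset.mem_range.2 hk)).trans (ENNReal.le_tsum n)
  have h2 : X n k ω ≤ (1 + S.toReal) ^ p := by
    calc X n k ω ≤ S.toReal := (ENNReal.ofReal_le_iff_le_toReal hω.ne).1 h1
      _ ≤ 1 + S.toReal := by linarith
      _ ≤ _ := le_self_pow₀ (by linarith) hp0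
  have h3 : e n ^ δ * (1 + |bifBmZ H K B (e n) ((k : ℝ) / 2 ^ n) ω|) ≤ 1 + S.toReal :=
    (pow_le_pow_iff_left₀ (by have := he0 n; positivity) (by positivity) hp0).1 h2
  have hHK0 : 0 < e n ^ (H * K) := Real.rpow_pos_of_pos (he0 n) _
  have h4 : B ((k : ℝ) / 2 ^ n + e n).toNNReal ω - B ((k : ℝ) / 2 ^ n).toNNReal ω =
      e n ^ (H * K) * bifBmZ H K B (e n) ((k : ℝ) / 2 ^ n) ω := by
    rw [bifBmZ]
    field_simp
  have h5 : e n ^ (H * K) = e n ^ γ * e n ^ δ := by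
    rw [← Real.rpow_add (he0 n), hδ]
    ring_nf
  change |B ((k : ℝ) / 2 ^ n + e n).toNNReal ω - B ((k : ℝ) / 2 ^ n).toNNReal ω| ≤ _ * e n ^ γ
  have hγn : 0 < e n ^ γ := Real.rpow_pos_of_pos (he0 n) _
  have hδn : 0 < e n ^ δ := Real.rpow_pos_of_pos (he0 n) _
  rw [h4, abs_mul, abs_of_pos hHK0, h5]
  nlinarith [abs_nonneg (bifBmZ H K B (e n) ((k : ℝ) / 2 ^ n) ω)]

end IsBifBm

/-! ### From the grid to all small increments -/

/-- For `N = ⌊ε ^ (-1/q)⌋`, the point `e = N ^ (-q)` of the grid approximates `ε` from above with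
relative error `O(ε ^ (1/q))`. -/
lemma grid_approx {q : ℕ} (hq : q ≠ 0) {ε : ℝ} (hε : ε ∈ Set.Ioc (0 : ℝ) 1) :
    ε ≤ ((⌊ε ^ (-(q : ℝ)⁻¹)⌋₊ : ℝ) ^ q)⁻¹ ∧ ((⌊ε ^ (-(q : ℝ)⁻¹)⌋₊ : ℝ) ^ q)⁻¹ ≤ 1 ∧
      ((⌊ε ^ (-(q : ℝ)⁻¹)⌋₊ : ℝ) ^ q)⁻¹ ≤ 2 ^ q * ε ∧
      ((⌊ε ^ (-(q : ℝ)⁻¹)⌋₊ : ℝ) ^ q)⁻¹ - ε ≤ q * 2 ^ (q + 1) * (ε * ε ^ (q : ℝ)⁻¹) := by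
  obtain ⟨hε0, hε1⟩ := hε
  have hq0 : (0 : ℝ) < q := by positivity
  set x := ε ^ (q : ℝ)⁻¹ with hx
  have hx0 : 0 < x := by positivity
  have hx1 : x ≤ 1 := Real.rpow_le_one hε0.le hε1 (by positivity)
  have hxq : x ^ q = ε := by
    rw [hx, ← Real.rpow_natCast, ← Real.rpow_mul hε0.le, inv_mul_cancel₀ hq0.ne', Real.rpow_one]
  rw [Real.rpow_neg hε0.le, ← hx]
  set N := ⌊x⁻¹⌋₊ with hN
  have hN1 : 1 ≤ N := Nat.le_floor (by simpa using one_le_inv₀ hx0 |>.2 hx1)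
  have hN1' : (1 : ℝ) ≤ N := by exact_mod_cast hN1
  have hN0 : (0 : ℝ) < N := by linarith
  have hNle : (N : ℝ) ≤ x⁻¹ := Nat.floor_le (by positivity)
  have hNlt : x⁻¹ < N + 1 := Nat.lt_floor_add_one _
  have hinv : (N : ℝ)⁻¹ ≤ 2 * x := by
    rw [inv_le_comm₀ hN0 (by positivity), mul_inv]
    linarith
  have h3 : ((N : ℝ) ^ q)⁻¹ ≤ 2 ^ q * ε := by
    rw [← inv_pow, ← hxq, ← mul_pow]
    gcongr
  refine ⟨?_, inv_le_one_of_one_le₀ (one_le_pow₀ hN1'), h3, ?_⟩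
  · rw [← hxq, ← inv_pow]
    gcongr
    rwa [le_inv_comm₀ hx0 hN0]
  · have h5 : (((N : ℝ) + 1) ^ q)⁻¹ ≤ ε := by
      rw [← hxq, ← inv_pow]
      gcongr
      rw [inv_le_comm₀ (by positivity) hx0]
      exact hNlt.le
    -- This is an instance of Bernoulli's inequality.
    have h6 : 1 - q * (N : ℝ)⁻¹ ≤ ((N : ℝ) / (N + 1)) ^ q := by
      have h7 := one_add_mul_le_pow (a := -((N : ℝ) + 1)⁻¹)
        (by
          have : ((N : ℝ) + 1)⁻¹ ≤ 1 := inv_le_one_of_one_le₀ (by linarith)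
          linarith) q
      have h8 : 1 + -((N : ℝ) + 1)⁻¹ = N / (N + 1) := by field_simp; ring
      rw [h8] at h7
      have h9 : ((N : ℝ) + 1)⁻¹ ≤ (N : ℝ)⁻¹ := inv_anti₀ hN0 (by linarith)
      have h10 := mul_le_mul_of_nonneg_left h9 hq0.le
      linarith
    have h11 : ((N : ℝ) ^ q)⁻¹ * ((N : ℝ) / (N + 1)) ^ q = (((N : ℝ) + 1) ^ q)⁻¹ := by
      rw [div_pow]
      field_simp
    have hNq : 0 < ((N : ℝ) ^ q)⁻¹ := by positivity
    calc ((N : ℝ) ^ q)⁻¹ - ε ≤ ((N : ℝ) ^ q)⁻¹ - (((N : ℝ) + 1) ^ q)⁻¹ := by linarith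
      _ = ((N : ℝ) ^ q)⁻¹ * (1 - ((N : ℝ) / (N + 1)) ^ q) := by rw [← h11]; ring
      _ ≤ ((N : ℝ) ^ q)⁻¹ * (q * (N : ℝ)⁻¹) := by gcongr; linarith
      _ ≤ (2 ^ q * ε) * (q * (2 * x)) := by gcongr
      _ = _ := by ring

/-- Comparison of the normalized increments of a Hölder function over `ε` and over an approximation
`e` of `ε` from above with relative error `O(ε ^ κ)`. -/
lemma exists_abs_increment_sub_le {γ h κ c d L : ℝ} (hγ : 0 ≤ γ) (hh : h ∈ Set.Ioc (0 : ℝ) 1)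
    (hc : 0 ≤ c) (hd : 0 ≤ d) (hL : 0 ≤ L) {b : ℝ → ℝ}
    (hb : ∀ s ∈ Set.Icc (0 : ℝ) 2, ∀ t ∈ Set.Icc (0 : ℝ) 2, |s - t| ≤ 1 →
      |b s - b t| ≤ L * |s - t| ^ γ) {ε e t : ℝ} (hε : 0 < ε) (he : ε ≤ e) (he1 : e ≤ 1)
    (hed : e ≤ d * ε) (hec : e - ε ≤ c * (ε * ε ^ κ)) (ht : t ∈ Set.Icc (0 : ℝ) 1) :
    |(b (t + ε) - b t) / ε ^ h - (b (t + e) - b t) / e ^ h| ≤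
      L * c ^ γ * ε ^ (γ + κ * γ - h) + L * d ^ γ * c * ε ^ (γ + κ - h) := by
  have he0 : 0 < e := hε.trans_le he
  have hεh : 0 < ε ^ h := by positivity
  have heh : 0 < e ^ h := by positivity
  have h1 : |b (t + ε) - b (t + e)| ≤ L * (c * (ε * ε ^ κ)) ^ γ := by
    have h2 : |t + ε - (t + e)| = e - ε := by
      rw [add_sub_add_left_eq_sub, abs_sub_comm, abs_of_nonneg (by linarith)]
    refine (hb _ ⟨by linarith [ht.1], by linarith [ht.2]⟩ _
      ⟨by linarith [ht.1], by linarith [ht.2]⟩ (by rw [h2]; linarith)).trans ?_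
    rw [h2]
    have : 0 ≤ e - ε := by linarith
    gcongr
  have h3 : |b (t + e) - b t| ≤ L * (d * ε) ^ γ := by
    have h4 : |t + e - t| = e := by rw [add_sub_cancel_left, abs_of_pos he0]
    refine (hb _ ⟨by linarith [ht.1], by linarith [ht.2]⟩ _
      ⟨by linarith [ht.1], by linarith [ht.2]⟩ (by rwa [h4])).trans ?_
    rw [h4]
    gcongr
  have h5 : (ε ^ h)⁻¹ - (e ^ h)⁻¹ ≤ (ε ^ h)⁻¹ * (c * ε ^ κ) := by
    have h6 : ε / e ≤ (ε / e) ^ h := by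
      calc ε / e = (ε / e) ^ (1 : ℝ) := (Real.rpow_one _).symm
        _ ≤ _ := Real.rpow_le_rpow_of_exponent_ge (by positivity) ((div_le_one he0).2 he) hh.2
    have h7 : (ε ^ h)⁻¹ - (e ^ h)⁻¹ = (ε ^ h)⁻¹ * (1 - (ε / e) ^ h) := by
      rw [Real.div_rpow hε.le he0.le]
      field_simp
    rw [h7]
    gcongr
    calc 1 - (ε / e) ^ h ≤ 1 - ε / e := by linarith
      _ = (e - ε) / e := by field_simp
      _ ≤ (c * (ε * ε ^ κ)) / ε := by
          have : 0 ≤ c * (ε * ε ^ κ) := by positivity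
          gcongr
      _ = _ := by field_simp
  have h8 : 0 ≤ (ε ^ h)⁻¹ - (e ^ h)⁻¹ := by
    rw [sub_nonneg]
    exact inv_anti₀ hεh (Real.rpow_le_rpow hε.le he hh.1.le)
  have e1 : (b (t + ε) - b t) / ε ^ h - (b (t + e) - b t) / e ^ h =
      (b (t + ε) - b (t + e)) * (ε ^ h)⁻¹ + (b (t + e) - b t) * ((ε ^ h)⁻¹ - (e ^ h)⁻¹) := by
    ring
  have e2 : ε ^ (γ + κ * γ - h) = (ε * ε ^ κ) ^ γ * (ε ^ h)⁻¹ := by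
    rw [Real.mul_rpow hε.le (by positivity), ← Real.rpow_mul hε.le, Real.rpow_sub hε,
      Real.rpow_add hε, div_eq_mul_inv]
  have e3 : ε ^ (γ + κ - h) = ε ^ γ * ε ^ κ * (ε ^ h)⁻¹ := by
    rw [Real.rpow_sub hε, Real.rpow_add hε, div_eq_mul_inv]
  rw [e1, e2, e3]
  refine (abs_add_le _ _).trans ?_
  rw [abs_mul, abs_mul, abs_of_pos (inv_pos.2 hεh), abs_of_nonneg h8]
  calc _ ≤ (L * (c * (ε * ε ^ κ)) ^ γ) * (ε ^ h)⁻¹ +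
        (L * (d * ε) ^ γ) * ((ε ^ h)⁻¹ * (c * ε ^ κ)) := by gcongr
    _ = _ := by
        rw [Real.mul_rpow hc (by positivity), Real.mul_rpow hd hε.le]
        ring

namespace IsBifBm

variable {Ω : Type*} [MeasurableSpace Ω] {P : Measure Ω} [IsProbabilityMeasure P]
  {H K : ℝ} {B : ℝ≥0 → Ω → ℝ} {f : ℝ → ℝ} {C : ℝ} {m : ℕ} {J : Set ℝ}

/-- Almost sure convergence as `ε ↓ 0` through all real values, for a process that is measurable
and has continuous paths throughout: by Hölder continuity `Z_ε` is uniformly close to `Z_e` for the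
grid point `e` next to `ε`. -/
lemma ae_tendsto_integral_of_continuous (hB : IsBifBm H K B P) (hH : H ∈ Set.Ioo (0 : ℝ) 1)
    (hK : K ∈ Set.Ioc (0 : ℝ) 1) (hm : ∀ t, Measurable (B t))
    (hc : ∀ ω, Continuous fun t => B t ω) (hf : PolyLip f C m) (hJ : MeasurableSet J)
    (hJ1 : J ⊆ Set.Icc 0 1) :
    ∀ᵐ ω ∂P, Tendsto (fun ε : ℝ => ∫ t in J, f (bifBmZ H K B ε t ω)) (𝓝[>] 0)
      (𝓝 (volume.real J * ∫ x, f x ∂(gaussianReal 0 ((2 : ℝ≥0) ^ (1 - K))))) := by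
  have hHK1 : H * K < 1 := by nlinarith [hH.1, hH.2, hK.1, hK.2]
  have hHK0 : 0 < H * K := mul_pos hH.1 hK.1
  obtain ⟨q, hq⟩ := exists_nat_ge (2 / ((2 - 2 * H * K) / 7))
  rw [div_le_iff₀ (by linarith)] at hq
  have hq0 : q ≠ 0 := by
    rintro rfl
    norm_num at hq
  set κ : ℝ := (q : ℝ)⁻¹ with hκ
  have hκ0 : 0 < κ := by positivity
  -- The Hölder exponent `γ` has to satisfy `γ (1 + κ) > H K`.
  obtain ⟨γ, hγ1, hγ2⟩ := exists_between
    (show H * K / (1 + κ) < H * K from div_lt_self hHK0 (by linarith))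
  have hγ0 : 0 < γ := lt_of_le_of_lt (by positivity) hγ1
  rw [div_lt_iff₀ (by positivity)] at hγ1
  have hex1 : 0 < γ + κ * γ - H * K := by linarith
  have hex2 : 0 < γ + κ - H * K := by
    have : κ * γ ≤ κ := mul_le_of_le_one_right hκ0.le (by linarith)
    linarith
  filter_upwards [hB.ae_tendsto_integral_grid hH hK hm hc hf hJ hJ1 hq,
    hB.ae_tendsto_integral_grid hH hK hm hc (polyLip_one_add_abs_pow (2 * m)) hJ hJ1 hq,
    hB.ae_exists_holder hH hK hm hc ⟨hγ0, hγ2⟩] with ω h1 h2 ⟨L, hL0, hL⟩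
  set N : ℝ → ℕ := fun ε => ⌊ε ^ (-κ)⌋₊ with hN
  set e : ℝ → ℝ := fun ε => ((N ε : ℝ) ^ q)⁻¹ with he
  have hNt : Tendsto N (𝓝[>] 0) atTop :=
    tendsto_nat_floor_atTop.comp (tendsto_rpow_neg_nhdsGT_zero (neg_neg_iff_pos.2 hκ0))
  set c : ℝ := q * 2 ^ (q + 1) with hcdef
  set D : ℝ → ℝ := fun ε => L * c ^ γ * ε ^ (γ + κ * γ - H * K) +
    L * (2 ^ q) ^ γ * c * ε ^ (γ + κ - H * K) with hD
  have hDt : Tendsto D (𝓝[>] 0) (𝓝 0) := by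
    have := ((tendsto_rpow_nhdsGT_zero hex1).const_mul (L * c ^ γ)).add
      ((tendsto_rpow_nhdsGT_zero hex2).const_mul (L * (2 ^ q) ^ γ * c))
    simpa using this
  have hc0 : 0 ≤ c := by positivity
  have hZ : ∀ ε ∈ Set.Ioc (0 : ℝ) 1, ∀ t ∈ J,
      |bifBmZ H K B ε t ω - bifBmZ H K B (e ε) t ω| ≤ D ε := by
    intro ε hε t ht
    obtain ⟨g1, g2, g3, g4⟩ := grid_approx hq0 hε
    exact exists_abs_increment_sub_le (b := fun t => B t.toNNReal ω) hγ0.le ⟨hHK0, hHK1.le⟩ hc0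
      (by positivity) hL0 hL hε.1 g1 g2 g3 g4 (hJ1 ht)
  have hcont := continuous_Z (H := H) (K := K) (hc ω)
  have hint : ∀ {g : ℝ → ℝ} (_ : Continuous g), IntegrableOn g J volume := fun hg =>
    (hg.continuousOn.integrableOn_compact isCompact_Icc).mono_set hJ1
  have hfint : ∀ ε, IntegrableOn (fun t => f (bifBmZ H K B ε t ω)) J volume := fun ε =>
    hint (hf.continuous.comp (hcont ε))
  have hmain := h1.comp hNt
  refine hmain.congr_dist ?_
  have hlim : Tendsto (fun ε => C * D ε * (1 + D ε) ^ m *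
      ∫ t in J, (1 + |bifBmZ H K B (e ε) t ω|) ^ (2 * m)) (𝓝[>] 0) (𝓝 0) := by
    have h3 := ((hDt.const_mul C).mul ((hDt.const_add 1).pow m)).mul (h2.comp hNt)
    simpa using h3
  refine squeeze_zero' (Eventually.of_forall fun _ => dist_nonneg) ?_ hlim
  filter_upwards [Ioc_mem_nhdsGT zero_lt_one] with ε hε
  have hε0 := hε.1
  have hD0 : 0 ≤ D ε := by positivity
  rw [dist_comm, Real.dist_eq, Function.comp_apply,
    ← integral_sub (hfint _) (hfint _),
    ← integral_const_mul, ← Real.norm_eq_abs]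
  refine norm_integral_le_of_norm_le ?_ ?_
  · apply hint
    have := hcont (e ε)
    fun_prop
  · filter_upwards [ae_restrict_mem hJ] with t ht
    have hC := hf.nonneg
    have hz := hZ ε hε t ht
    rw [Real.norm_eq_abs]
    refine (hf.bound _ _).trans ?_
    change C * |bifBmZ H K B ε t ω - bifBmZ H K B (e ε) t ω| *
      ((1 + |bifBmZ H K B ε t ω|) * (1 + |bifBmZ H K B (e ε) t ω|)) ^ m ≤ _
    set x := bifBmZ H K B ε t ω
    set y := bifBmZ H K B (e ε) t ω
    have hx : 1 + |x| ≤ (1 + D ε) * (1 + |y|) := by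
      have h4 : |x| ≤ |y| + |x - y| := by
        have := abs_add_le y (x - y)
        rwa [add_sub_cancel] at this
      nlinarith [mul_nonneg hD0 (abs_nonneg y)]
    calc C * |x - y| * ((1 + |x|) * (1 + |y|)) ^ m
        ≤ C * D ε * (((1 + D ε) * (1 + |y|)) * (1 + |y|)) ^ m := by gcongr
      _ = _ := by rw [mul_assoc (1 + D ε), ← sq, mul_pow, ← pow_mul]; ring

end IsBifBm

/-! ### Ramp functions -/

/-- The piecewise linear function equal to `1` on `(-∞, a]` and to `0` on `[b, ∞)`, for `a < b`. -/
noncomputable def ramp (a b x : ℝ) : ℝ := max 0 (min 1 ((b - x) / (b - a)))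

lemma ramp_nonneg (a b x : ℝ) : 0 ≤ ramp a b x := le_max_left _ _

lemma ramp_le_one (a b x : ℝ) : ramp a b x ≤ 1 := max_le zero_le_one (min_le_left _ _)

lemma ramp_eq_one {a b x : ℝ} (hab : a < b) (hx : x ≤ a) : ramp a b x = 1 := by
  have h : 1 ≤ (b - x) / (b - a) := by
    rw [one_le_div (sub_pos.2 hab)]
    linarith
  rw [ramp, min_eq_left h, max_eq_right zero_le_one]

lemma ramp_eq_zero {a b x : ℝ} (hab : a < b) (hx : b ≤ x) : ramp a b x = 0 := by
  have h : (b - x) / (b - a) ≤ 0 :=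
    div_nonpos_of_nonpos_of_nonneg (by linarith) (by linarith)
  exact max_eq_left ((min_le_right _ _).trans h)

lemma polyLip_ramp {a b : ℝ} (hab : a < b) : PolyLip (ramp a b) (b - a)⁻¹ 0 where
  nonneg := inv_nonneg.2 (sub_nonneg.2 hab.le)
  bound x y := by
    have hba : 0 < b - a := sub_pos.2 hab
    have h1 : |ramp a b x - ramp a b y| ≤ |(b - x) / (b - a) - (b - y) / (b - a)| := by
      have h2 := abs_max_sub_max_le_abs (min 1 ((b - x) / (b - a))) (min 1 ((b - y) / (b - a))) 0
      have h3 := abs_min_sub_min_le_max 1 ((b - x) / (b - a)) 1 ((b - y) / (b - a))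
      rw [sub_self, abs_zero, max_eq_right (abs_nonneg _)] at h3
      rw [ramp, ramp, max_comm 0, max_comm 0]
      exact h2.trans h3
    refine h1.trans_eq ?_
    rw [← sub_div, sub_sub_sub_cancel_left, abs_div, abs_of_pos hba, abs_sub_comm, pow_zero,
      mul_one, div_eq_inv_mul]

/-! ### Distribution functions and regular versions -/

lemma continuous_measureReal_Iic (μ : Measure ℝ) [IsProbabilityMeasure μ]
    [NullSingletonClass μ] : Continuous fun x => μ.real (Set.Iic x) := by
  rw [continuous_iff_continuousAt]
  intro x
  have h := IntegrableOn.continuousOn_Iic_primitive_Iic (μ := μ) (f := fun _ => (1 : ℝ))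
    (a₀ := x + 1) (integrable_const _).integrableOn
  have h2 := h.continuousAt (Iic_mem_nhds (lt_add_one x))
  simpa using h2

/-- A process with almost surely continuous paths agrees, outside a null set, with a process all of
whose paths are continuous and all of whose marginals are measurable. -/
lemma exists_measurable_continuous_version {Ω : Type*} [MeasurableSpace Ω] {P : Measure Ω}
    {B : ℝ≥0 → Ω → ℝ} (hB : ∀ t, AEMeasurable (B t) P)
    (hcont : ∀ᵐ ω ∂P, Continuous fun t => B t ω) :
    ∃ B' : ℝ≥0 → Ω → ℝ, (∀ t, Measurable (B' t)) ∧ (∀ ω, Continuous fun t => B' t ω) ∧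
      ∀ᵐ ω ∂P, ∀ t, B t ω = B' t ω := by
  classical
  set d := TopologicalSpace.denseSeq ℝ≥0 with hd
  have hae : ∀ᵐ ω ∂P, (Continuous fun t => B t ω) ∧ ∀ n, B (d n) ω = (hB (d n)).mk _ ω :=
    hcont.and (ae_all_iff.2 fun n => (hB (d n)).ae_eq_mk)
  set N := toMeasurable P {ω | ¬ ((Continuous fun t => B t ω) ∧
    ∀ n, B (d n) ω = (hB (d n)).mk _ ω)} with hN
  have hN0 : P N = 0 := by rw [hN, measure_toMeasurable]; exact hae
  have hNm : MeasurableSet Nᶜ := (measurableSet_toMeasurable _ _).compl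
  have hgood : ∀ ω ∈ Nᶜ, (Continuous fun t => B t ω) ∧ ∀ n, B (d n) ω = (hB (d n)).mk _ ω := by
    intro ω hω
    by_contra h
    exact hω (subset_toMeasurable P _ h)
  have hc : ∀ ω, Continuous fun t => Nᶜ.indicator (B t) ω := by
    intro ω
    by_cases hω : ω ∈ Nᶜ
    · simpa only [Set.indicator_of_mem hω] using (hgood ω hω).1
    · simp only [Set.indicator_of_notMem hω]
      exact continuous_const
  refine ⟨fun t => Nᶜ.indicator (B t), fun t => ?_, hc, ?_⟩
  · obtain ⟨u, hu, hut⟩ := mem_closure_iff_seq_limit.1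
      ((TopologicalSpace.denseRange_denseSeq ℝ≥0) t)
    refine measurable_of_tendsto_metrizable (f := fun n => Nᶜ.indicator (B (u n))) (fun n => ?_)
      (tendsto_pi_nhds.2 fun ω => ((hc ω).tendsto t).comp hut)
    obtain ⟨k, hk⟩ := hu n
    have : Nᶜ.indicator (B (u n)) = Nᶜ.indicator ((hB (d k)).mk _) := by
      refine Set.indicator_congr fun ω hω => ?_
      rw [← hk]
      exact (hgood ω hω).2 k
    rw [this]
    exact (hB (d k)).measurable_mk.indicator hNm
  · filter_upwards [compl_mem_ae_iff.2 hN0] with ω hω t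
    exact (Set.indicator_of_mem hω _).symm

namespace IsBifBm

variable {Ω : Type*} [MeasurableSpace Ω] {P : Measure Ω} {H K : ℝ} {B : ℝ≥0 → Ω → ℝ}

lemma congr {B' : ℝ≥0 → Ω → ℝ} (hB : IsBifBm H K B P) (h : ∀ t, B t =ᵐ[P] B' t) :
    IsBifBm H K B' P where
  isGaussianProcess := hB.isGaussianProcess.congr h
  centered t := by rw [← integral_congr_ae (h t)]; exact hB.centered t
  covariance_eq s t := by
    rw [← hB.covariance_eq s t, covariance, covariance, integral_congr_ae (h s),
      integral_congr_ae (h t)]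
    refine integral_congr_ae ?_
    filter_upwards [h s, h t] with ω h1 h2
    rw [h1, h2]
  start_zero := by
    filter_upwards [hB.start_zero, h 0] with ω h1 h2
    rw [← h2, h1]

/-- Almost surely, under Lebesgue measure on `J` the increments `Z_ε` integrate `f` in the limit
like a centered normal variable of variance `2 ^ (1 - K)`. -/
theorem ae_tendsto_integral_comp [IsProbabilityMeasure P] (hB : IsBifBm H K B P)
    (hH : H ∈ Set.Ioo (0 : ℝ) 1) (hK : K ∈ Set.Ioc (0 : ℝ) 1)
    (hcont : ∀ᵐ ω ∂P, Continuous fun t => B t ω) {f : ℝ → ℝ} {C : ℝ} {m : ℕ} (hf : PolyLip f C m)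
    {J : Set ℝ} (hJ : MeasurableSet J) (hJ1 : J ⊆ Set.Icc 0 1) :
    ∀ᵐ ω ∂P, Tendsto (fun ε : ℝ => ∫ t in J, f (bifBmZ H K B ε t ω)) (𝓝[>] 0)
      (𝓝 (volume.real J * ∫ x, f x ∂(gaussianReal 0 ((2 : ℝ≥0) ^ (1 - K))))) := by
  obtain ⟨B', hm, hc, hBB'⟩ :=
    exists_measurable_continuous_version hB.isGaussianProcess.aemeasurable hcont
  have hB' : IsBifBm H K B' P := hB.congr fun t => by
    filter_upwards [hBB'] with ω hω using hω t
  filter_upwards [hBB', hB'.ae_tendsto_integral_of_continuous hH hK hm hc hf hJ hJ1] with ω h1 h2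
  simpa only [bifBmZ, h1] using h2

end IsBifBm

/-- Convergence of the integrals of the countably many ramps with rational endpoints implies
convergence of the distribution functions at every point, because indicators of half-lines can be
squeezed between ramps and the limit distribution function is continuous. -/
lemma tendsto_measureReal_le_of_tendsto_ramp {ι : Type*} {l : Filter ι} {J : Set ℝ}
    (hJfin : volume J ≠ ⊤) {μ : Measure ℝ} [IsProbabilityMeasure μ]
    [NullSingletonClass μ] {Z : ι → ℝ → ℝ} (hZ : ∀ i, Continuous (Z i))
    (h : ∀ a b : ℚ, a < b → Tendsto (fun i => ∫ t in J, ramp a b (Z i t)) l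
      (𝓝 (volume.real J * ∫ x, ramp a b x ∂μ))) (x : ℝ) :
    Tendsto (fun i => volume.real {t ∈ J | Z i t ≤ x}) l
      (𝓝 (volume.real J * μ.real (Set.Iic x))) := by
  have : IsFiniteMeasure (volume.restrict J : Measure ℝ) :=
    ⟨by rw [Measure.restrict_apply_univ]; exact hJfin.lt_top⟩
  have hcont : Continuous fun y => volume.real J * μ.real (Set.Iic y) :=
    (continuous_measureReal_Iic μ).const_mul _
  have hset : ∀ i, volume.real {t ∈ J | Z i t ≤ x} =
      ∫ t in J, Set.indicator (Set.Iic x) (fun _ => (1 : ℝ)) (Z i t) := by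
    intro i
    have hms : MeasurableSet {t | Z i t ≤ x} := measurableSet_le (hZ i).measurable measurable_const
    have h1 : (fun t => Set.indicator (Set.Iic x) (fun _ => (1 : ℝ)) (Z i t)) =
        Set.indicator {t | Z i t ≤ x} fun _ => (1 : ℝ) := by
      ext t; simp [Set.indicator_apply]
    rw [h1, integral_indicator_const _ hms, measureReal_restrict_apply hms, smul_eq_mul, mul_one,
      Set.inter_comm]
    rfl
  have hintR : ∀ {a b : ℚ}, a < b → ∀ i, IntegrableOn (fun t => ramp a b (Z i t)) J volume := by
    intro a b hab i
    have hab' : (a : ℝ) < b := by exact_mod_cast hab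
    refine Integrable.of_bound (C := 1)
      ((polyLip_ramp hab').continuous.comp (hZ i)).aestronglyMeasurable (ae_of_all _ fun t => ?_)
    rw [Real.norm_of_nonneg (ramp_nonneg _ _ _)]
    exact ramp_le_one _ _ _
  have hintI : ∀ i, IntegrableOn (fun t => Set.indicator (Set.Iic x) (fun _ => (1 : ℝ)) (Z i t)) J
      volume := by
    intro i
    refine Integrable.of_bound (C := 1) (((measurable_const.indicator measurableSet_Iic).comp
      (hZ i).measurable).aestronglyMeasurable) (ae_of_all _ fun t => ?_)
    by_cases ht : Z i t ∈ Set.Iic x <;> simp [ht]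
  have hintμ : ∀ {a b : ℚ}, a < b → Integrable (fun x => ramp a b x) μ := by
    intro a b hab
    have hab' : (a : ℝ) < b := by exact_mod_cast hab
    refine Integrable.of_bound (C := 1)
      (polyLip_ramp hab').continuous.aestronglyMeasurable (ae_of_all _ fun t => ?_)
    rw [Real.norm_of_nonneg (ramp_nonneg _ _ _)]
    exact ramp_le_one _ _ _
  have hμind : ∀ y, μ.real (Set.Iic y) =
      ∫ z, Set.indicator (Set.Iic y) (fun _ => (1 : ℝ)) z ∂μ := by
    intro y
    rw [integral_indicator_const _ measurableSet_Iic, smul_eq_mul, mul_one]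
  have hintIμ : ∀ y, Integrable (Set.indicator (Set.Iic y) fun _ => (1 : ℝ)) μ := fun y =>
    (integrable_const _).indicator measurableSet_Iic
  have hrl : ∀ {a b y z : ℝ}, a < b → b ≤ y →
      ramp a b z ≤ Set.indicator (Set.Iic y) (fun _ => (1 : ℝ)) z := by
    intro a b y z hab hby
    by_cases hz : z ≤ y
    · rw [Set.indicator_of_mem (show z ∈ Set.Iic y from hz)]
      exact ramp_le_one _ _ _
    · rw [Set.indicator_of_notMem (show z ∉ Set.Iic y from hz),
        ramp_eq_zero hab (hby.trans (not_le.1 hz).le)]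
  have hlr : ∀ {a b y z : ℝ}, a < b → y ≤ a →
      Set.indicator (Set.Iic y) (fun _ => (1 : ℝ)) z ≤ ramp a b z := by
    intro a b y z hab hya
    by_cases hz : z ≤ y
    · rw [Set.indicator_of_mem (show z ∈ Set.Iic y from hz), ramp_eq_one hab (hz.trans hya)]
    · rw [Set.indicator_of_notMem (show z ∉ Set.Iic y from hz)]
      exact ramp_nonneg _ _ _
  simp_rw [hset]
  refine tendsto_order.2 ⟨fun c hc => ?_, fun c hc => ?_⟩
  · obtain ⟨y, hy, hyc⟩ : ∃ y < x, c < volume.real J * μ.real (Set.Iic y) := by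
      obtain ⟨y, hy1, hy2⟩ := ((hcont.tendsto x).eventually_const_lt hc |>.filter_mono
        nhdsWithin_le_nhds |>.and self_mem_nhdsWithin : ∀ᶠ y in 𝓝[<] x, _ ∧ y ∈ Set.Iio x).exists
      exact ⟨y, hy2, hy1⟩
    obtain ⟨a, ha1, ha2⟩ := exists_rat_btwn hy
    obtain ⟨b, hb1, hb2⟩ := exists_rat_btwn ha2
    have hab : a < b := by exact_mod_cast hb1
    have hlt : c < volume.real J * ∫ z, ramp a b z ∂μ := by
      refine hyc.trans_le (mul_le_mul_of_nonneg_left ?_ measureReal_nonneg)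
      rw [hμind]
      exact integral_mono (hintIμ y) (hintμ hab) fun z => hlr hb1 ha1.le
    filter_upwards [(h a b hab).eventually_const_lt hlt] with i hi
    exact hi.trans_le (integral_mono (hintR hab i) (hintI i) fun t => hrl hb1 hb2.le)
  · obtain ⟨y, hy, hyc⟩ : ∃ y, x < y ∧ volume.real J * μ.real (Set.Iic y) < c := by
      obtain ⟨y, hy1, hy2⟩ := ((hcont.tendsto x).eventually_lt_const hc |>.filter_mono
        nhdsWithin_le_nhds |>.and self_mem_nhdsWithin : ∀ᶠ y in 𝓝[>] x, _ ∧ y ∈ Set.Ioi x).exists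
      exact ⟨y, hy2, hy1⟩
    obtain ⟨a, ha1, ha2⟩ := exists_rat_btwn hy
    obtain ⟨b, hb1, hb2⟩ := exists_rat_btwn ha2
    have hab : a < b := by exact_mod_cast hb1
    have hlt : volume.real J * ∫ z, ramp a b z ∂μ < c := by
      refine lt_of_le_of_lt (mul_le_mul_of_nonneg_left ?_ measureReal_nonneg) hyc
      rw [hμind]
      exact integral_mono (hintμ hab) (hintIμ y) fun z => hrl hb1 hb2.le
    filter_upwards [(h a b hab).eventually_lt_const hlt] with i hi
    exact lt_of_le_of_lt (integral_mono (hintI i) (hintR hab i) fun t => hlr hb1 ha1.le) hi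

/-! ### Convergence of moments and of distribution functions -/

theorem proposition4p6 {Ω : Type*} [MeasurableSpace Ω] (P : Measure Ω) [IsProbabilityMeasure P]
    (H K : ℝ) (hH : H ∈ Set.Ioo (0 : ℝ) 1) (hK : K ∈ Set.Ioc (0 : ℝ) 1)
    (B : ℝ≥0 → Ω → ℝ) (hB : IsBifBm H K B P)
    (hcont : ∀ᵐ ω ∂P, Continuous fun t => B t ω)
    {Ω' : Type*} [MeasurableSpace Ω'] (Q : Measure Ω') [IsProbabilityMeasure Q]
    (ρ : Ω' → ℝ) (hρ : HasLaw ρ (gaussianReal 0 ((2 : ℝ≥0) ^ (1 - K))) Q) :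
    (∀ k : ℕ, 1 ≤ k → ∀ᵐ ω ∂P,
      Tendsto (fun ε : ℝ => ∫ t in (0 : ℝ)..1, bifBmZ H K B ε t ω ^ k)
        (𝓝[>] 0) (𝓝 (∫ ω', ρ ω' ^ k ∂Q))) ∧
    (∀ J : Set ℝ, J.OrdConnected → J ⊆ Set.Icc 0 1 → ∀ᵐ ω ∂P, ∀ x : ℝ,
      Tendsto (fun ε : ℝ => volume {t ∈ J | bifBmZ H K B ε t ω ≤ x})
        (𝓝[>] 0) (𝓝 (volume J * Q {ω' | ρ ω' ≤ x}))) := by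
  refine ⟨fun k _ => ?_, fun J hJ hJ1 => ?_⟩
  · have hρk : ∫ ω', ρ ω' ^ k ∂Q = ∫ x, x ^ k ∂(gaussianReal 0 ((2 : ℝ≥0) ^ (1 - K))) := by
      rw [← hρ.map_eq, integral_map hρ.aemeasurable (by fun_prop)]
    filter_upwards [hB.ae_tendsto_integral_comp hH hK hcont (polyLip_pow k)
      (measurableSet_Ioc (a := (0 : ℝ)) (b := 1)) Set.Ioc_subset_Icc_self] with ω hω
    simp_rw [hρk, intervalIntegral.integral_of_le zero_le_one]
    simpa using hω
  · have hJm : MeasurableSet J := hJ.measurableSet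
    have hJfin : volume J ≠ ⊤ := ((measure_mono hJ1).trans_lt (by simp)).ne
    set v : ℝ≥0 := (2 : ℝ≥0) ^ (1 - K) with hv
    have hv0 : v ≠ 0 := (NNReal.rpow_pos two_pos).ne'
    have := nullSingletonClass_gaussianReal (μ := 0) hv0
    have hramp : ∀ᵐ ω ∂P, ∀ a b : ℚ, a < b →
        Tendsto (fun ε : ℝ => ∫ t in J, ramp a b (bifBmZ H K B ε t ω)) (𝓝[>] 0)
          (𝓝 (volume.real J * ∫ x, ramp a b x ∂(gaussianReal 0 v))) := by
      refine ae_all_iff.2 fun a => ae_all_iff.2 fun b => ?_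
      by_cases hab : a < b
      · filter_upwards [hB.ae_tendsto_integral_comp hH hK hcont
          (polyLip_ramp (show (a : ℝ) < b by exact_mod_cast hab)) hJm hJ1] with ω hω _ using hω
      · exact ae_of_all _ fun ω h => absurd h hab
    filter_upwards [hramp, hcont] with ω hω hωc x
    have hZ := IsBifBm.continuous_Z (H := H) (K := K) hωc
    have hlim := tendsto_measureReal_le_of_tendsto_ramp hJfin hZ hω x
    have hQ : Q {ω' | ρ ω' ≤ x} = gaussianReal 0 v (Set.Iic x) := by
      rw [← hρ.map_eq, Measure.map_apply_of_aemeasurable hρ.aemeasurable measurableSet_Iic]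
      rfl
    have hfin : ∀ ε, volume {t ∈ J | bifBmZ H K B ε t ω ≤ x} ≠ ⊤ := fun ε =>
      ne_top_of_le_ne_top hJfin (measure_mono (Set.sep_subset _ _))
    rw [hQ, ← ENNReal.tendsto_toReal_iff hfin (ENNReal.mul_ne_top hJfin (measure_ne_top _ _)),
      ENNReal.toReal_mul]
    exact hlim
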